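/- Let $l\in\mathbb N$, and let $C=C([0,1];\mathbb R^l)$ with canonical process $X_t(\omega)=\omega(t)$ and $\sigma$-algebra $\mathcal F=\sigma(X_t:t\in[0,1])$. For $n\ge 1$ put $\mathcal F^n=\sigma(X_{k/n}:k=0,\dots,n)$, and for probability measures $\mathbb Q,\mathbb P$ on $(C,\mathcal F)$ let $H(\mathbb Q|\mathbb P)|_{\mathcal F^n}\in[0,\infty]$ be the relative entropy of $\mathbb Q|_{\mathcal F^n}$ with respect to $\mathbb P|_{\mathcal F^n}$, that is $\int\log\frac{d\mathbb Q}{d\mathbb P}\big|_{\mathcal F^n}\,d\mathbb Q$ if $\mathbb Q|_{\mathcal F^n}\ll\mathbb P|_{\mathcal F^n}$, and $+\infty$ otherwise. The specific relative entropy is $$h_l(\mathbb Q|\mathbb P)=\liminf_{n\to\infty}2^{-n}H(\mathbb Q|\mathbb P)|_{\mathcal F^{2^n}}.$$ Let $G:[0,1]\to\mathbb R^{l\times l}$ have symmetric positive semidefinite values (for instance, positive definite values) and Lebesgue-integrable entries. Let $B$ be a standard $\mathbb R^l$-valued Brownian motion on $[0,1]$ with continuous paths, and let $\mathbb B$ be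 its law on $(C,\mathcal F)$. Let $\mathbb Q^a$ be the law on $(C,\mathcal F)$ of the continuous Gaussian martingale $\int_0^\cdot G(s)^{1/2}\,dB_s$, whose covariance matrix at time $t$ is $a(t)=\int_0^tG(s)\,ds$. With the convention $-\log 0=+\infty$, the function $\operatorname{tr}G-l-\log\det G$ takes values in $[0,\infty]$, and $$h_l(\mathbb Q^a|\mathbb B)=\frac12\int_0^1\big(\operatorname{tr}G(s)-l-\log\det G(s)\big)\,ds=\sup_{n\ge1}\frac1n H(\mathbb Q^a|\mathbb B)|_{\mathcal F^n}\in[0,\infty].$$ Moreover, if this value is finite, then $\mathbb Q^a|_{\mathcal F^n}\ll\mathbb B|_{\mathcal F^n}$ and $\log\frac{d\mathbb Q^a}{d\mathbb B}\big|_{\mathcal F^n}\in L^1(\mathbb Q^a)$ for every $n\ge1$, and $$\frac1n\log\frac{d\mathbb Q^a}{d\mathbb B}\Big|_{\mathcal F^n}\longrightarrow\frac12\int_0^1\big(\operatorname{tr}G(s)-l-\log\det G(s)\big)\,ds\qquad\text{in }L^1(\mathbb Q^a)\text{ as }n\to\infty.$$ -/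

import Mathlib

open MeasureTheory ProbabilityTheory InformationTheory Filter Topology
open scoped ENNReal Matrix MatrixOrder

noncomputable section

/-- The space `C([0,1]; ℝ^l)` of continuous `ℝ^l`-valued paths. -/
abbrev PathSpace (l : ℕ) : Type := C(unitInterval, EuclideanSpace ℝ (Fin l))

/-- The σ-algebra `𝓕 = σ(X_t : t ∈ [0,1])` generated by the canonical process `X_t(ω) = ω(t)`. -/
instance pathSigma (l : ℕ) : MeasurableSpace (PathSpace l) :=
  ⨆ t : unitInterval, MeasurableSpace.comap (fun ω : PathSpace l => ω t) inferInstance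

/-- The grid point `k/n` of `[0,1]`, for `0 ≤ k ≤ n`. -/
def gridPoint (n : ℕ) (k : Fin (n + 1)) : unitInterval :=
  ⟨(k : ℝ) / n, by positivity,
    div_le_one_of_le₀ (by exact_mod_cast Nat.lt_succ_iff.mp k.isLt) (by positivity)⟩

/-- The σ-algebra `𝓕ⁿ = σ(X_{k/n} : k = 0, …, n)`. -/
@[reducible] def gridSigma (l n : ℕ) : MeasurableSpace (PathSpace l) :=
  ⨆ k : Fin (n + 1),
    MeasurableSpace.comap (fun ω : PathSpace l => ω (gridPoint n k)) inferInstance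

theorem gridSigma_le (l n : ℕ) : gridSigma l n ≤ pathSigma l :=
  iSup_le fun k => le_iSup
    (fun t : unitInterval =>
      MeasurableSpace.comap (fun ω : PathSpace l => ω t) inferInstance) (gridPoint n k)

/-- The restriction `Q|_{𝓕ⁿ}` of a measure on path space to the σ-algebra `𝓕ⁿ`. -/
def gridRestrict {l : ℕ} (n : ℕ) (Q : Measure (PathSpace l)) :
    @Measure (PathSpace l) (gridSigma l n) :=
  Q.trim (gridSigma_le l n)

/-- The relative entropy `H(Q|P)|_{𝓕ⁿ}` of the restrictions of `Q` and `P` to `𝓕ⁿ`,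
an element of `[0,∞]`. For probability measures `klDiv μ ν` is `∫ log (dμ/dν) dμ` when `μ ≪ ν`
(`∞` if this integral diverges) and `∞` otherwise. -/
def gridEntropy {l : ℕ} (n : ℕ) (Q P : Measure (PathSpace l)) : ℝ≥0∞ :=
  klDiv (gridRestrict n Q) (gridRestrict n P)

/-- The log-density `log (dQ/dP)|_{𝓕ⁿ}` of the restrictions to `𝓕ⁿ`. -/
def gridLogDensity {l : ℕ} (n : ℕ) (Q P : Measure (PathSpace l)) : PathSpace l → ℝ :=
  llr (gridRestrict n Q) (gridRestrict n P)

/-- The specific relative entropy `h_l(Q|P) = liminf_n 2⁻ⁿ H(Q|P)|_{𝓕^{2ⁿ}}`. -/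
def specificRelativeEntropy {l : ℕ} (Q P : Measure (PathSpace l)) : ℝ≥0∞ :=
  liminf (fun n : ℕ => gridEntropy (2 ^ n) Q P / 2 ^ n) atTop

/-- A random continuous path `B` is a standard `ℝ^l`-valued Brownian motion on `[0,1]`: it starts
at `0`, has independent increments, and `B_t - B_s ~ N(0, (t - s) I)` for `s ≤ t`. -/
structure IsStandardBrownianMotion {l : ℕ} {Ω : Type*} [MeasurableSpace Ω]
    (B : Ω → PathSpace l) (P : Measure Ω) : Prop where
  measurable : Measurable B
  start_zero : ∀ᵐ ω ∂P, B ω 0 = 0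
  indep_increments : HasIndepIncrements (fun (t : unitInterval) ω => B ω t) P
  increment_law : ∀ s t : unitInterval, s ≤ t →
    P.map (fun ω => B ω t - B ω s) =
      multivariateGaussian 0 (((t : ℝ) - s) • (1 : Matrix (Fin l) (Fin l) ℝ))

/-- A deterministic matrix-valued step function `∑ₖ Aₖ 1_{(tₖ, tₖ₊₁]}` on `[0,1]`. -/
structure MatrixStep (l : ℕ) where
  /-- number of steps -/
  size : ℕ
  /-- partition points -/
  time : Fin (size + 1) → unitInterval
  time_mono : Monotone time
  /-- the value `Aₖ` taken on `(tₖ, tₖ₊₁]` -/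
  value : Fin size → Matrix (Fin l) (Fin l) ℝ

/-- The value at `s` of a step function. -/
def MatrixStep.eval {l : ℕ} (φ : MatrixStep l) (s : ℝ) : Matrix (Fin l) (Fin l) ℝ :=
  ∑ k : Fin φ.size,
    (Set.Ioc (φ.time k.castSucc : ℝ) (φ.time k.succ)).indicator (fun _ => φ.value k) s

/-- The elementary integral `∫_0^t φ dw = ∑ₖ Aₖ (w(tₖ₊₁ ∧ t) - w(tₖ ∧ t))` of a step function
against a path `w`. -/
def MatrixStep.integral {l : ℕ} (φ : MatrixStep l) (w : PathSpace l) (t : unitInterval) :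
    EuclideanSpace ℝ (Fin l) :=
  ∑ k : Fin φ.size,
    Matrix.toEuclideanLin (φ.value k)
      (w (min (φ.time k.succ) t) - w (min (φ.time k.castSucc) t))

/-- The random continuous path `M` is (a continuous version of) the stochastic integral
`∫_0^· K(s) dB_s` of the deterministic matrix-valued function `K`: there are step functions
`φₙ → K` in `L²([0,1])` with `∫_0^t φₙ dB → M_t` in `L²(P)` for every `t ∈ [0,1]`. By the Itô
isometry, this determines `M` up to indistinguishability, and the choice of `φₙ` is immaterial. -/
structure IsWienerIntegral {l : ℕ} {Ω : Type*} [MeasurableSpace Ω]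
    (K : ℝ → Matrix (Fin l) (Fin l) ℝ) (B M : Ω → PathSpace l) (P : Measure Ω) : Prop where
  measurable : Measurable M
  approx : ∃ φ : ℕ → MatrixStep l,
    (∀ i j, Tendsto (fun n => eLpNorm (fun s => (φ n).eval s i j - K s i j) 2
      (volume.restrict (Set.Icc (0 : ℝ) 1))) atTop (𝓝 0)) ∧
    ∀ t : unitInterval,
      Tendsto (fun n => eLpNorm (fun ω => (φ n).integral (B ω) t - M ω t) 2 P) atTop (𝓝 0)

/-- `F_l(S) = ½ (tr S - l - log det S) ∈ [0,∞]` for a positive semidefinite matrix `S`, where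
`-log 0 = ∞`. (The real number `tr S - l - log det S` is nonnegative for positive definite `S`.) -/
def entropyRate {l : ℕ} (S : Matrix (Fin l) (Fin l) ℝ) : ℝ≥0∞ :=
  if S.det = 0 then ∞ else ENNReal.ofReal ((1 / 2) * (S.trace - l - Real.log S.det))

end

/-!
On the grid `k/n`, a path that starts at `0` is determined by its increments. The increments of the
Gaussian martingale `M` are independent centered Gaussian vectors with covariance matrices
`Σₖ = ∫ G` over `(k/n, (k+1)/n]` (`cellCov`), and those of Brownian motion have covariance `1/n`.
Expanding the `k`-th increment in an eigenbasis of `Σₖ` turns both laws into products of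
one-dimensional centered Gaussian measures (`exists_basis_map_gridIncr`). Hence, with
`F = entropyRate`, `H|_{𝓕ⁿ} = ∑ₖ F(n Σₖ)` (`gridEntropy_eq_sum`), and this is infinite precisely
when some `Σₖ` is singular.

*Law of the increments.* A linear combination of increments of an elementary integral is a linear
combination of values of the Brownian path, hence Gaussian, and its variance is the squared `L²` norm
of the integrand (`IsStandardBrownianMotion.map_eq_of_mem_stepPairs`). Both properties pass to
`L²` limits through characteristic functions (`IsWienerIntegral.map_sum_inner_increments`).

*Upper bound.* `F` is convex: it lies above its tangents, because `log det S ≤ log det A +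
tr(A⁻¹ S) - l`, and it is infinite on singular matrices. Since `n Σₖ` is the mean of `G` over the
`k`-th cell, Jensen's inequality (`entropyRate_integral_le`) gives `H|_{𝓕ⁿ} / n ≤ ∫ F(G)` for every
`n` (`gridEntropy_div_le`).

*Lower bound.* `H|_{𝓕ⁿ} / n = ∫ F(Gₙ)`, where `Gₙ` is constant on each cell and equal to the mean
of `G` there. By Lebesgue's differentiation theorem `Gₙ → G` almost everywhere, `F` is continuous
with values in `[0,∞]` (`tendsto_entropyRate`), and Fatou's lemma gives `∫ F(G) ≤ liminf H|_{𝓕ⁿ} / n`.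
So `H|_{𝓕ⁿ} / n` converges to `∫ F(G)` (`tendsto_gridEntropy_div`), which by the upper bound is also
its supremum, and the specific relative entropy is the limit along the powers of `2`.

*Convergence of the log-densities.* The mean of the log-density under the law of `M` is the entropy
`H|_{𝓕ⁿ}`. If `∫ F(G)` is finite, the log-density is a sum of independent quadratic functions of
Gaussian variables, and its variance, divided by `n²`, is at most a constant times
`∑ₖ (tr Σₖ)² + l/n` (`gridLogDensity_of_lintegral_ne_top`). The sum tends to `0`, because
`t ↦ ∫_0^t tr G` is continuous and increasing (`tendsto_sum_trace_cellCov_sq`).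
-/

/-! ### Convexity and continuity of `entropyRate` -/

theorem Matrix.PosSemidef.log_det_le_trace_sub {l : ℕ} {S : Matrix (Fin l) (Fin l) ℝ}
    (hS : S.PosSemidef) (hdet : S.det ≠ 0) : Real.log S.det ≤ S.trace - l := by
  have hpos : S.PosDef := hS.posDef_iff_det_ne_zero.2 hdet
  have h1 := hpos.1.det_eq_prod_eigenvalues
  have h2 := hpos.1.trace_eq_sum_eigenvalues
  simp only [RCLike.ofReal_real_eq_id, id] at h1 h2
  rw [h1, h2, Real.log_prod fun i _ => (hpos.eigenvalues_pos i).ne']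
  calc ∑ i, Real.log (hpos.1.eigenvalues i) ≤ ∑ i, (hpos.1.eigenvalues i - 1) :=
        Finset.sum_le_sum fun i _ => Real.log_le_sub_one_of_pos (hpos.eigenvalues_pos i)
    _ = _ := by simp

/-- Concavity of `log det`: the tangent at `A` lies above it. With `C = A^{-1/2}`, this is the
inequality `log det ≤ tr - l` for `C S C`. -/
theorem Matrix.PosDef.log_det_le_tangent {l : ℕ} {A S : Matrix (Fin l) (Fin l) ℝ}
    (hA : A.PosDef) (hS : S.PosSemidef) (hdet : S.det ≠ 0) :
    Real.log S.det ≤ Real.log A.det + (A⁻¹ * S).trace - l := by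
  set C : Matrix (Fin l) (Fin l) ℝ := CFC.sqrt A⁻¹ with hC
  have hCC : C * C = A⁻¹ := CFC.sqrt_mul_sqrt_self _ hA.inv.posSemidef.nonneg
  have hCpos : C.PosSemidef := Matrix.nonneg_iff_posSemidef.1 (CFC.sqrt_nonneg A⁻¹)
  have hCH : Cᴴ = C := hCpos.1
  have hS' : (Cᴴ * S * C).PosSemidef := hS.conjTranspose_mul_mul_same C
  rw [hCH] at hS'
  have hdC : C.det * C.det = A.det⁻¹ := by
    rw [← Matrix.det_mul, hCC, Matrix.det_nonsing_inv, Ring.inverse_eq_inv']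
  have hAd : 0 < A.det := hA.det_pos
  have hdS' : (C * S * C).det = A.det⁻¹ * S.det := by
    rw [Matrix.det_mul, Matrix.det_mul, ← hdC]; ring
  have hne : (C * S * C).det ≠ 0 := by rw [hdS']; positivity
  have key := hS'.log_det_le_trace_sub hne
  rw [hdS', Real.log_mul (by positivity) hdet, Real.log_inv, Matrix.trace_mul_comm,
    ← Matrix.mul_assoc, hCC] at key
  linarith

theorem entropyRate_of_det_ne_zero {l : ℕ} {S : Matrix (Fin l) (Fin l) ℝ} (h : S.det ≠ 0) :
    entropyRate S = ENNReal.ofReal ((1 / 2) * (S.trace - l - Real.log S.det)) := if_neg h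

theorem entropyRate_of_det_eq_zero {l : ℕ} {S : Matrix (Fin l) (Fin l) ℝ} (h : S.det = 0) :
    entropyRate S = ∞ := if_pos h

theorem aemeasurable_matrix_det {l : ℕ} {α : Type*} [MeasurableSpace α] {ν : Measure α}
    {G : α → Matrix (Fin l) (Fin l) ℝ} (hG : ∀ i j, AEMeasurable (fun s => G s i j) ν) :
    AEMeasurable (fun s => (G s).det) ν := by
  simp only [Matrix.det_apply]
  refine Finset.aemeasurable_fun_sum _ fun σ _ => ?_
  exact (Finset.aemeasurable_fun_prod _ fun i _ => hG _ _).const_smul _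

theorem aemeasurable_matrix_trace {l : ℕ} {α : Type*} [MeasurableSpace α] {ν : Measure α}
    {G : α → Matrix (Fin l) (Fin l) ℝ} (hG : ∀ i j, AEMeasurable (fun s => G s i j) ν) :
    AEMeasurable (fun s => (G s).trace) ν := by
  simp only [Matrix.trace]
  exact Finset.aemeasurable_fun_sum _ fun i _ => hG _ _

theorem aemeasurable_entropyRate {l : ℕ} {α : Type*} [MeasurableSpace α] {ν : Measure α}
    {G : α → Matrix (Fin l) (Fin l) ℝ} (hG : ∀ i j, AEMeasurable (fun s => G s i j) ν) :
    AEMeasurable (fun s => entropyRate (G s)) ν := by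
  have hd := aemeasurable_matrix_det hG
  have ht := aemeasurable_matrix_trace hG
  have hF : Measurable (fun p : ℝ × ℝ => if p.1 = 0 then ∞ else
      ENNReal.ofReal ((1 / 2) * (p.2 - l - Real.log p.1))) := by
    refine Measurable.ite (measurableSet_eq_fun measurable_fst measurable_const)
      measurable_const ?_
    fun_prop
  exact hF.comp_aemeasurable (hd.prodMk ht)

theorem dotProduct_mulVec_integral {l : ℕ} {α : Type*} [MeasurableSpace α] {ν : Measure α}
    {G : α → Matrix (Fin l) (Fin l) ℝ}
    (hint : ∀ i j, Integrable (fun s => G s i j) ν) (x : Fin l → ℝ) :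
    Integrable (fun s => x ⬝ᵥ (G s *ᵥ x)) ν ∧
    x ⬝ᵥ ((Matrix.of fun i j => ∫ s, G s i j ∂ν) *ᵥ x) = ∫ s, x ⬝ᵥ (G s *ᵥ x) ∂ν := by
  simp only [dotProduct, Matrix.mulVec, Matrix.of_apply, Finset.mul_sum]
  have h1 : ∀ i j, Integrable (fun s => x i * (G s i j * x j)) ν := fun i j =>
    ((hint i j).mul_const _).const_mul _
  refine ⟨integrable_finsetSum _ fun i _ => integrable_finsetSum _ fun j _ => h1 i j, ?_⟩
  rw [integral_finsetSum _ fun i _ => integrable_finsetSum _ fun j _ => h1 i j]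
  refine Finset.sum_congr rfl fun i _ => ?_
  rw [integral_finsetSum _ fun j _ => h1 i j]
  refine Finset.sum_congr rfl fun j _ => ?_
  rw [integral_const_mul, integral_mul_const]

/-- The mean of a matrix-valued function, entry by entry, is positive semidefinite if its values
are. -/
theorem posSemidef_integral {l : ℕ} {α : Type*} [MeasurableSpace α] {ν : Measure α}
    {G : α → Matrix (Fin l) (Fin l) ℝ} (hG : ∀ᵐ s ∂ν, (G s).PosSemidef)
    (hint : ∀ i j, Integrable (fun s => G s i j) ν) :
    (Matrix.of fun i j => ∫ s, G s i j ∂ν).PosSemidef := by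
  refine Matrix.PosSemidef.of_dotProduct_mulVec_nonneg ?_ fun x => ?_
  · ext i j
    simp only [Matrix.conjTranspose_apply, Matrix.of_apply, star_trivial]
    refine integral_congr_ae ?_
    filter_upwards [hG] with s hs
    simpa using hs.1.apply i j
  · rw [star_trivial, (dotProduct_mulVec_integral hint x).2]
    refine integral_nonneg_of_ae ?_
    filter_upwards [hG] with s hs using hs.dotProduct_mulVec_nonneg x

/-- Jensen's inequality for the convex function `entropyRate`. -/
theorem entropyRate_integral_le {l : ℕ} {α : Type*} [MeasurableSpace α] {ν : Measure α}
    [IsProbabilityMeasure ν] {G : α → Matrix (Fin l) (Fin l) ℝ}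
    (hG : ∀ᵐ s ∂ν, (G s).PosSemidef) (hint : ∀ i j, Integrable (fun s => G s i j) ν) :
    entropyRate (Matrix.of fun i j => ∫ s, G s i j ∂ν) ≤ ∫⁻ s, entropyRate (G s) ∂ν := by
  have hA := posSemidef_integral hG hint
  have hx := dotProduct_mulVec_integral hint
  set A : Matrix (Fin l) (Fin l) ℝ := Matrix.of fun i j => ∫ s, G s i j ∂ν with hAdef
  by_cases hdet : A.det = 0
  · -- a null vector of the mean is almost surely a null vector of `G s`
    obtain ⟨x, hx0, hAx⟩ := Matrix.exists_mulVec_eq_zero_iff.2 hdet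
    have h0 : ∫ s, x ⬝ᵥ (G s *ᵥ x) ∂ν = 0 := by rw [← (hx x).2, hAx, dotProduct_zero]
    rw [integral_eq_zero_iff_of_nonneg_ae] at h0
    · have : ∀ᵐ s ∂ν, entropyRate (G s) = ∞ := by
        filter_upwards [h0, hG] with s hs hGs
        refine entropyRate_of_det_eq_zero (Matrix.exists_mulVec_eq_zero_iff.1 ⟨x, hx0, ?_⟩)
        exact (hGs.dotProduct_mulVec_zero_iff x).1 (by simpa using hs)
      rw [lintegral_congr_ae this]
      simp
    · filter_upwards [hG] with s hs using hs.dotProduct_mulVec_nonneg x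
    · exact (hx x).1
  · have hpos : A.PosDef := hA.posDef_iff_det_ne_zero.2 hdet
    -- `g` is the affine minorant of `entropyRate` that touches it at the mean
    set g : α → ℝ := fun s =>
      (1 / 2) * ((G s).trace - Real.log A.det - (A⁻¹ * G s).trace) with hg
    have hmul : ∀ i k, Integrable (fun s => A⁻¹ i k * G s k i) ν := fun i k =>
      (hint k i).const_mul _
    have htr : Integrable (fun s => (G s).trace) ν :=
      integrable_finsetSum _ fun i _ => hint i i
    have htr2 : Integrable (fun s => (A⁻¹ * G s).trace) ν := by
      simp only [Matrix.trace, Matrix.diag_apply, Matrix.mul_apply]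
      exact integrable_finsetSum _ fun i _ => integrable_finsetSum _ fun k _ => hmul i k
    have hi1 : ∫ s, (G s).trace ∂ν = A.trace := by
      simp only [Matrix.trace, Matrix.diag_apply]
      rw [integral_finsetSum _ fun i _ => hint i i]
      rfl
    have hi2 : ∫ s, (A⁻¹ * G s).trace ∂ν = l := by
      have : ∫ s, (A⁻¹ * G s).trace ∂ν = (A⁻¹ * A).trace := by
        simp only [Matrix.trace, Matrix.diag_apply, Matrix.mul_apply]
        rw [integral_finsetSum _ fun i _ => integrable_finsetSum _ fun k _ => hmul i k]
        refine Finset.sum_congr rfl fun i _ => ?_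
        rw [integral_finsetSum _ fun k _ => hmul i k]
        refine Finset.sum_congr rfl fun k _ => ?_
        rw [integral_const_mul]
        rfl
      rw [this, Matrix.nonsing_inv_mul _ (by simpa using hdet)]
      simp
    have htr' : Integrable (fun s => (G s).trace - Real.log A.det) ν :=
      htr.sub (integrable_const _)
    have hgi : ∫ s, g s ∂ν = (1 / 2) * (A.trace - l - Real.log A.det) := by
      rw [hg, integral_const_mul, integral_sub htr' htr2,
        integral_sub htr (integrable_const _), hi1, hi2]
      simp
      ring
    have hgint : Integrable g ν := (htr'.sub htr2).const_mul _
    calc entropyRate A = ENNReal.ofReal (∫ s, g s ∂ν) := by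
          rw [entropyRate_of_det_ne_zero hdet, hgi]
      _ ≤ ∫⁻ s, ENNReal.ofReal (g s) ∂ν := by
          rw [integral_eq_lintegral_pos_part_sub_lintegral_neg_part hgint]
          refine (ENNReal.ofReal_le_ofReal (sub_le_self _ ENNReal.toReal_nonneg)).trans ?_
          exact ENNReal.ofReal_toReal_le
      _ ≤ ∫⁻ s, entropyRate (G s) ∂ν := by
          refine lintegral_mono_ae ?_
          filter_upwards [hG] with s hs
          by_cases hd : (G s).det = 0
          · rw [entropyRate_of_det_eq_zero hd]; exact le_top
          · rw [entropyRate_of_det_ne_zero hd]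
            refine ENNReal.ofReal_le_ofReal ?_
            have := hpos.log_det_le_tangent hs hd
            simp only [hg]
            linarith

/-- `entropyRate` is continuous on the positive semidefinite matrices, as a function with values
in `[0,∞]`. -/
theorem tendsto_entropyRate {l : ℕ} {ι : Type*} {L : Filter ι}
    {S : ι → Matrix (Fin l) (Fin l) ℝ} {A : Matrix (Fin l) (Fin l) ℝ}
    (hS : ∀ n, (S n).PosSemidef) (h : ∀ i j, Tendsto (fun n => S n i j) L (𝓝 (A i j))) :
    Tendsto (fun n => entropyRate (S n)) L (𝓝 (entropyRate A)) := by
  have hSA : Tendsto S L (𝓝 A) :=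
    tendsto_pi_nhds.2 fun i => tendsto_pi_nhds.2 fun j => h i j
  have hdet : Tendsto (fun n => (S n).det) L (𝓝 A.det) :=
    ((continuous_id.matrix_det).tendsto A).comp hSA
  have htr : Tendsto (fun n => (S n).trace) L (𝓝 A.trace) :=
    ((continuous_id.matrix_trace).tendsto A).comp hSA
  by_cases hA : A.det = 0
  · rw [entropyRate_of_det_eq_zero hA, ENNReal.tendsto_nhds_top_iff_nnreal]
    intro x
    have h1 : ∀ᶠ n in L, (S n).det < Real.exp (-(2 * x + 2 + l) + (A.trace - 1)) :=
      hdet.eventually_lt_const (by rw [hA]; positivity)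
    have h2 : ∀ᶠ n in L, A.trace - 1 < (S n).trace := htr.eventually_const_lt (by linarith)
    filter_upwards [h1, h2] with n hn1 hn2
    by_cases hd : (S n).det = 0
    · rw [entropyRate_of_det_eq_zero hd]; exact ENNReal.coe_lt_top
    · rw [entropyRate_of_det_ne_zero hd, ← ENNReal.ofReal_coe_nnreal]
      have hpos : 0 < (S n).det := lt_of_le_of_ne (hS n).det_nonneg (Ne.symm hd)
      have hlog := (Real.log_lt_iff_lt_exp hpos).2 hn1
      have hx : (0 : ℝ) ≤ x := x.2
      exact (ENNReal.ofReal_lt_ofReal_iff (by linarith)).2 (by linarith)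
  · have hev : ∀ᶠ n in L, (S n).det ≠ 0 := hdet.eventually_ne hA
    rw [entropyRate_of_det_ne_zero hA]
    refine Tendsto.congr' (f₁ := fun n =>
      ENNReal.ofReal ((1 / 2) * ((S n).trace - l - Real.log (S n).det))) ?_ ?_
    · filter_upwards [hev] with n hn using (entropyRate_of_det_ne_zero hn).symm
    · exact ENNReal.tendsto_ofReal
        (((htr.sub_const _).sub ((Real.continuousAt_log hA).tendsto.comp hdet)).const_mul _)

/-! ### Brownian motion and the Wiener isometry for step functions -/

theorem measurable_path_eval {l : ℕ} (t : unitInterval) :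
    Measurable (fun ω : PathSpace l => ω t) :=
  (comap_measurable (fun ω : PathSpace l => ω t)).mono
    (le_iSup (fun t : unitInterval =>
      MeasurableSpace.comap (fun ω : PathSpace l => ω t) inferInstance) t) le_rfl

section Brownian

variable {l : ℕ} {Ω : Type*} {B : Ω → PathSpace l}

theorem IsStandardBrownianMotion.hasLaw_eval [MeasurableSpace Ω] {P : Measure Ω}
    (hB : IsStandardBrownianMotion B P)
    (t : unitInterval) :
    HasLaw (fun ω => B ω t)
      (multivariateGaussian 0 ((t : ℝ) • (1 : Matrix (Fin l) (Fin l) ℝ))) P where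
  aemeasurable := ((measurable_path_eval t).comp hB.measurable).aemeasurable
  map_eq := by
    have h := hB.increment_law 0 t unitInterval.nonneg'
    rw [Set.Icc.coe_zero, sub_zero] at h
    rw [← h]
    refine Measure.map_congr ?_
    filter_upwards [hB.start_zero] with ω hω
    rw [hω, sub_zero]

theorem IsStandardBrownianMotion.isGaussianProcess [MeasurableSpace Ω] {P : Measure Ω}
    [IsProbabilityMeasure P] (hB : IsStandardBrownianMotion B P) :
    IsGaussianProcess (fun (t : unitInterval) ω => B ω t) P :=
  hB.indep_increments.isGaussianProcess (fun t => (hB.hasLaw_eval t).hasGaussianLaw)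
    hB.start_zero

theorem IsStandardBrownianMotion.memLp_inner [MeasurableSpace Ω] {P : Measure Ω}
    [IsProbabilityMeasure P] (hB : IsStandardBrownianMotion B P)
    (v : EuclideanSpace ℝ (Fin l)) (r : unitInterval) :
    MemLp (fun ω => inner ℝ v (B ω r)) 2 P :=
  (((hB.hasLaw_eval r).hasGaussianLaw).map_fun (innerSL ℝ v)).memLp_two

theorem IsStandardBrownianMotion.integral_inner [MeasurableSpace Ω] {P : Measure Ω}
    [IsProbabilityMeasure P] (hB : IsStandardBrownianMotion B P)
    (v : EuclideanSpace ℝ (Fin l)) (r : unitInterval) :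
    ∫ ω, inner ℝ v (B ω r) ∂P = 0 := by
  have hi : Integrable (fun ω => B ω r) P := (hB.hasLaw_eval r).hasGaussianLaw.integrable
  rw [_root_.integral_inner hi]
  have : ∫ ω, B ω r ∂P = 0 := by
    rw [(hB.hasLaw_eval r).integral_eq, integral_id_multivariateGaussian]
  rw [this, inner_zero_right]

/-- The covariance of Brownian motion, tested against vectors: `𝔼 ⟪v, B_r⟫⟪w, B_s⟫ =
⟪v, w⟫ (r ∧ s)`. -/
theorem IsStandardBrownianMotion.covariance_inner [MeasurableSpace Ω] {P : Measure Ω}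
    [IsProbabilityMeasure P] (hB : IsStandardBrownianMotion B P)
    (v w : EuclideanSpace ℝ (Fin l)) (r s : unitInterval) :
    cov[fun ω => inner ℝ v (B ω r), fun ω => inner ℝ w (B ω s); P]
      = inner ℝ v w * min (r : ℝ) s := by
  -- the case of equal times is the covariance matrix of a Gaussian vector
  have hdiag : ∀ (v w : EuclideanSpace ℝ (Fin l)) (r : unitInterval),
      cov[fun ω => inner ℝ v (B ω r), fun ω => inner ℝ w (B ω r); P]
        = inner ℝ v w * r := by
    intro v w r
    have hpsd : ((r : ℝ) • (1 : Matrix (Fin l) (Fin l) ℝ)).PosSemidef :=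
      Matrix.PosSemidef.one.smul r.2.1
    have h := covarianceBilin_multivariateGaussian (μ := 0) hpsd v w
    rw [covarianceBilin_apply_eq_cov (IsGaussian.memLp_two_id),
      ← (hB.hasLaw_eval r).map_eq,
      covariance_map (by fun_prop) (by fun_prop) (hB.hasLaw_eval r).aemeasurable] at h
    refine h.trans ?_
    rw [EuclideanSpace.inner_eq_star_dotProduct]
    simp [Matrix.smul_mulVec, dotProduct_comm, mul_comm]
  have key : ∀ (v w : EuclideanSpace ℝ (Fin l)) (r s : unitInterval), r ≤ s →
      cov[fun ω => inner ℝ v (B ω r), fun ω => inner ℝ w (B ω s); P] = inner ℝ v w * r := by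
    intro v w r s hrs
    have hind : IndepFun (fun ω => B ω r) (fun ω => B ω s - B ω r) P :=
      hB.indep_increments.indepFun_eval_sub (r := 0) unitInterval.nonneg' hrs hB.start_zero
    have hind' : IndepFun (fun ω => inner ℝ v (B ω r)) (fun ω => inner ℝ w (B ω s - B ω r)) P :=
      hind.comp (φ := fun x => inner ℝ v x) (ψ := fun x => inner ℝ w x)
        (by fun_prop) (by fun_prop)
    have hm : MemLp (fun ω => inner ℝ w (B ω s - B ω r)) 2 P := by
      simp only [inner_sub_right]
      exact (hB.memLp_inner w s).sub (hB.memLp_inner w r)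
    have heq : (fun ω => inner ℝ w (B ω s))
        = (fun ω => inner ℝ w (B ω r)) + fun ω => inner ℝ w (B ω s - B ω r) := by
      ext ω
      simp [inner_sub_right]
    rw [heq, covariance_add_right (hB.memLp_inner v r) (hB.memLp_inner w r) hm,
      hdiag, hind'.covariance_eq_zero (hB.memLp_inner v r) hm, add_zero]
  rcases le_total r s with h | h
  · rw [key v w r s h, min_eq_left (by exact_mod_cast h)]
  · rw [covariance_comm, key w v s r h, min_eq_right (by exact_mod_cast h), real_inner_comm]

/-- The space of pairs `(∫ ⟨ψ, dB⟩, ψ)` with `ψ` a step function: the linear span of the pairs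
`(⟨v, B_r⟩, v 1_{(0,r]})`. -/
def stepPairs (B : Ω → PathSpace l) :
    Submodule ℝ ((Ω → ℝ) × (ℝ → EuclideanSpace ℝ (Fin l))) :=
  Submodule.span ℝ (Set.range fun p : EuclideanSpace ℝ (Fin l) × unitInterval =>
    ((fun ω => inner ℝ p.1 (B ω p.2)),
      (Set.Ioc (0 : ℝ) p.2).indicator fun _ => p.1))

theorem exists_sum_of_mem_stepPairs {Y : Ω → ℝ} {ψ : ℝ → EuclideanSpace ℝ (Fin l)}
    (h : (Y, ψ) ∈ stepPairs B) :
    ∃ (n : ℕ) (v : Fin n → EuclideanSpace ℝ (Fin l)) (r : Fin n → unitInterval),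
      Y = (fun ω => ∑ i, inner ℝ (v i) (B ω (r i))) ∧
      ψ = (fun s => ∑ i, (Set.Ioc (0 : ℝ) (r i)).indicator (fun _ => v i) s) := by
  obtain ⟨n, f, g, hfg⟩ := Submodule.mem_span_set'.1 h
  choose p hp using fun i => (g i).2
  refine ⟨n, fun i => f i • (p i).1, fun i => (p i).2, ?_, ?_⟩
  · have h1 : _ = Y := congrArg Prod.fst hfg
    rw [← h1, Prod.fst_sum]
    ext ω
    simp [← hp, inner_smul_left]
  · have h1 : _ = ψ := congrArg Prod.snd hfg
    rw [← h1, Prod.snd_sum]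
    ext1 s
    rw [Finset.sum_apply]
    refine Finset.sum_congr rfl fun i _ => ?_
    simp only [← hp, Prod.smul_snd, Pi.smul_apply]
    by_cases hs : s ∈ Set.Ioc (0 : ℝ) ((p i).2 : ℝ) <;> simp [Set.indicator, hs]

theorem measurable_of_mem_stepPairs [MeasurableSpace Ω] (hB : Measurable B) {Y : Ω → ℝ}
    {ψ : ℝ → EuclideanSpace ℝ (Fin l)} (h : (Y, ψ) ∈ stepPairs B) :
    Measurable Y ∧ MemLp ψ 2 (volume.restrict (Set.Icc (0 : ℝ) 1)) := by
  obtain ⟨n, v, r, rfl, rfl⟩ := exists_sum_of_mem_stepPairs h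
  constructor
  · refine Finset.measurable_fun_sum _ fun i _ => ?_
    have := (measurable_path_eval (r i)).comp hB
    exact Measurable.inner measurable_const this
  · exact memLp_finsetSum _ fun i _ => (memLp_const _).indicator measurableSet_Ioc

theorem integral_norm_sq_sum_indicator {n : ℕ} (v : Fin n → EuclideanSpace ℝ (Fin l))
    (r : Fin n → unitInterval) :
    ∫ s in Set.Icc (0 : ℝ) 1, ‖∑ i, (Set.Ioc (0 : ℝ) (r i)).indicator (fun _ => v i) s‖ ^ 2
      = ∑ i, ∑ j, inner ℝ (v i) (v j) * min (r i : ℝ) (r j) := by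
  have h1 : ∀ s : ℝ, ‖∑ i, (Set.Ioc (0 : ℝ) (r i)).indicator (fun _ => v i) s‖ ^ 2
      = ∑ i, ∑ j, (Set.Ioc (0 : ℝ) (min (r i : ℝ) (r j))).indicator
          (fun _ => inner ℝ (v i) (v j)) s := by
    intro s
    rw [← real_inner_self_eq_norm_sq, sum_inner]
    refine Finset.sum_congr rfl fun i _ => ?_
    rw [inner_sum]
    refine Finset.sum_congr rfl fun j _ => ?_
    simp only [Set.indicator, Set.mem_Ioc, le_min_iff]
    split_ifs <;> simp_all
  have h2 : ∀ i j, IntegrableOn ((Set.Ioc (0 : ℝ) (min (r i : ℝ) (r j))).indicator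
      (fun _ => inner ℝ (v i) (v j))) (Set.Icc 0 1) := fun i j =>
    (integrable_const _).indicator measurableSet_Ioc
  simp_rw [h1]
  rw [integral_finsetSum _ fun i _ => integrable_finsetSum _ fun j _ => h2 i j]
  refine Finset.sum_congr rfl fun i _ => ?_
  rw [integral_finsetSum _ fun j _ => h2 i j]
  refine Finset.sum_congr rfl fun j _ => ?_
  have hmin : 0 ≤ min (r i : ℝ) (r j) := le_min (r i).2.1 (r j).2.1
  have hsub : Set.Ioc (0 : ℝ) (min (r i : ℝ) (r j)) ⊆ Set.Icc 0 1 := fun s hs =>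
    ⟨hs.1.le, hs.2.trans ((min_le_left _ _).trans (r i).2.2)⟩
  rw [setIntegral_indicator measurableSet_Ioc, setIntegral_const, smul_eq_mul, mul_comm,
    Set.inter_eq_right.2 hsub]
  simp [hmin]

/-- The Wiener isometry, together with Gaussianity, for step functions. -/
theorem IsStandardBrownianMotion.map_eq_of_mem_stepPairs [MeasurableSpace Ω] {P : Measure Ω}
    [IsProbabilityMeasure P] (hB : IsStandardBrownianMotion B P)
    {Y : Ω → ℝ} {ψ : ℝ → EuclideanSpace ℝ (Fin l)} (h : (Y, ψ) ∈ stepPairs B) :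
    P.map Y = gaussianReal 0 (∫ s in Set.Icc (0 : ℝ) 1, ‖ψ s‖ ^ 2).toNNReal := by
  obtain ⟨n, v, r, rfl, rfl⟩ := exists_sum_of_mem_stepPairs h
  have hgp : IsGaussianProcess (fun (i : Fin n) ω => inner ℝ (v i) (B ω (r i))) P :=
    (hB.isGaussianProcess.comp_right r).comp_left fun i => innerSL ℝ (v i)
  have hg : HasGaussianLaw (fun ω => ∑ i, inner ℝ (v i) (B ω (r i))) P :=
    hgp.hasGaussianLaw_fun_sum (I := Finset.univ)
  rw [hg.map_eq_gaussianReal]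
  congr 1
  · rw [integral_finsetSum _ fun i _ => (hB.memLp_inner (v i) (r i)).integrable one_le_two]
    exact Finset.sum_eq_zero fun i _ => hB.integral_inner _ _
  · congr 1
    rw [integral_norm_sq_sum_indicator,
      variance_fun_sum fun i => hB.memLp_inner (v i) (r i)]
    simp_rw [hB.covariance_inner]

end Brownian

/-! ### The law of the increments of a Wiener integral -/

/-- Convergence in `L²` implies convergence of the squared norms. -/
theorem tendsto_integral_norm_sq {α E : Type*} [MeasurableSpace α] [NormedAddCommGroup E]
    {μ : Measure α} {f : ℕ → α → E} {g : α → E} (hf : ∀ n, MemLp (f n) 2 μ) (hg : MemLp g 2 μ)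
    (h : Tendsto (fun n => eLpNorm (f n - g) 2 μ) atTop (𝓝 0)) :
    Tendsto (fun n => ∫ x, ‖f n x‖ ^ 2 ∂μ) atTop (𝓝 (∫ x, ‖g x‖ ^ 2 ∂μ)) := by
  have key : ∀ {u : α → E}, MemLp u 2 μ → ∫ x, ‖u x‖ ^ 2 ∂μ = (eLpNorm u 2 μ).toReal ^ 2 := by
    intro u hu
    have h0 : 0 ≤ ∫ x, ‖u x‖ ^ 2 ∂μ := integral_nonneg fun x => by positivity
    rw [hu.eLpNorm_eq_integral_rpow_norm two_ne_zero ENNReal.ofNat_ne_top,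
      ENNReal.toReal_ofReal (by positivity), ENNReal.toReal_ofNat]
    simp only [Real.rpow_ofNat]
    rw [← Real.rpow_natCast, ← Real.rpow_mul h0]
    norm_num
  have h1 := ((Lp.tendsto_Lp_iff_tendsto_eLpNorm'' f hf g hg).2 h).norm.pow 2
  simp only [Lp.norm_toLp] at h1
  simpa only [key (hf _), key hg] using h1

theorem inner_toEuclideanLin {l : ℕ} (A : Matrix (Fin l) (Fin l) ℝ)
    (c x : EuclideanSpace ℝ (Fin l)) :
    inner ℝ c (Matrix.toEuclideanLin A x) = inner ℝ (Matrix.toEuclideanLin Aᵀ c) x := by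
  have h := Matrix.toEuclideanLin_conjTranspose_eq_adjoint A
  rw [Matrix.conjTranspose_eq_transpose_of_trivial] at h
  rw [h, LinearMap.adjoint_inner_left]

theorem toEuclideanLin_transpose_eq_sum {l : ℕ} (A : Matrix (Fin l) (Fin l) ℝ)
    (c : EuclideanSpace ℝ (Fin l)) :
    Matrix.toEuclideanLin Aᵀ c
      = ∑ i, (∑ j, A j i * c j) • EuclideanSpace.single i (1 : ℝ) := by
  ext k
  simp [Matrix.toEuclideanLin, Matrix.mulVec, dotProduct, Pi.single_apply]

theorem norm_toEuclideanLin_transpose_le {l : ℕ} (A : Matrix (Fin l) (Fin l) ℝ)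
    (c : EuclideanSpace ℝ (Fin l)) :
    ‖Matrix.toEuclideanLin Aᵀ c‖ ≤ ∑ i, ∑ j, ‖c j‖ * ‖A j i‖ := by
  rw [toEuclideanLin_transpose_eq_sum]
  refine (norm_sum_le _ _).trans (Finset.sum_le_sum fun i _ => ?_)
  rw [norm_smul, PiLp.norm_single, norm_one, mul_one]
  refine (norm_sum_le _ _).trans (Finset.sum_le_sum fun j _ => ?_)
  rw [norm_mul, mul_comm]

theorem aestronglyMeasurable_toEuclideanLin {l : ℕ} {α : Type*} [MeasurableSpace α]
    {μ : Measure α} {K : α → Matrix (Fin l) (Fin l) ℝ}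
    (hK : ∀ i j, AEMeasurable (fun s => K s i j) μ) (c : EuclideanSpace ℝ (Fin l)) :
    AEStronglyMeasurable (fun s => Matrix.toEuclideanLin (K s)ᵀ c) μ := by
  simp_rw [toEuclideanLin_transpose_eq_sum]
  refine AEMeasurable.aestronglyMeasurable (Finset.aemeasurable_fun_sum _ fun i _ => ?_)
  exact (Finset.aemeasurable_fun_sum _ fun j _ => (hK j i).mul_const _).smul_const _

section StepIntegral

variable {l : ℕ} {Ω : Type*} {B : Ω → PathSpace l}

theorem inner_mem_stepPairs (B : Ω → PathSpace l) (v : EuclideanSpace ℝ (Fin l))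
    (r : unitInterval) :
    ((fun ω => inner ℝ v (B ω r)), (Set.Ioc (0 : ℝ) r).indicator fun _ => v) ∈ stepPairs B :=
  Submodule.subset_span ⟨(v, r), rfl⟩

/-- An elementary integral up to time `t`, tested against `c`, is the linear combination of values of
the path that corresponds to the integrand `φᵀ c` on `(0, t]`. -/
theorem stepIntegral_mem_stepPairs (B : Ω → PathSpace l) (φ : MatrixStep l)
    (c : EuclideanSpace ℝ (Fin l)) (t : unitInterval) :
    ((fun ω => inner ℝ c (φ.integral (B ω) t)),
      (Set.Ioc (0 : ℝ) t).indicator fun s => Matrix.toEuclideanLin (φ.eval s)ᵀ c)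
      ∈ stepPairs B := by
  have h : ((fun ω => inner ℝ c (φ.integral (B ω) t)),
      (Set.Ioc (0 : ℝ) t).indicator fun s => Matrix.toEuclideanLin (φ.eval s)ᵀ c)
      = ∑ k : Fin φ.size,
        ((((fun ω => inner ℝ (Matrix.toEuclideanLin (φ.value k)ᵀ c)
            (B ω (min (φ.time k.succ) t))),
          (Set.Ioc (0 : ℝ) (min (φ.time k.succ) t : unitInterval)).indicator
            fun _ => Matrix.toEuclideanLin (φ.value k)ᵀ c) :
            (Ω → ℝ) × (ℝ → EuclideanSpace ℝ (Fin l)))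
        - ((fun ω => inner ℝ (Matrix.toEuclideanLin (φ.value k)ᵀ c)
            (B ω (min (φ.time k.castSucc) t))),
          (Set.Ioc (0 : ℝ) (min (φ.time k.castSucc) t : unitInterval)).indicator
            fun _ => Matrix.toEuclideanLin (φ.value k)ᵀ c)) := by
    refine Prod.ext ?_ ?_
    · rw [Prod.fst_sum]
      ext ω
      simp only [MatrixStep.integral, inner_sum, inner_toEuclideanLin, inner_sub_right,
        Finset.sum_apply, Prod.fst_sub, Pi.sub_apply]
    · rw [Prod.snd_sum]
      ext1 s
      rw [Finset.sum_apply]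
      by_cases hs : s ∈ Set.Ioc (0 : ℝ) t
      · dsimp only
        rw [Set.indicator_of_mem hs]
        have he : Matrix.toEuclideanLin (φ.eval s)ᵀ c = ∑ k : Fin φ.size,
            (Set.Ioc (φ.time k.castSucc : ℝ) (φ.time k.succ)).indicator
              (fun _ => Matrix.toEuclideanLin (φ.value k)ᵀ c) s := by
          rw [MatrixStep.eval, Matrix.transpose_sum, map_sum, LinearMap.sum_apply]
          refine Finset.sum_congr rfl fun k _ => ?_
          by_cases hk : s ∈ Set.Ioc (φ.time k.castSucc : ℝ) (φ.time k.succ)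
          · rw [Set.indicator_of_mem hk, Set.indicator_of_mem hk]
          · rw [Set.indicator_of_notMem hk, Set.indicator_of_notMem hk]
            simp
        rw [he]
        refine Finset.sum_congr rfl fun k _ => ?_
        have hmono : (φ.time k.castSucc : ℝ) ≤ φ.time k.succ :=
          φ.time_mono (Fin.castSucc_le_succ k)
        have hmin : ∀ r : unitInterval, ((min r t : unitInterval) : ℝ) = min (r : ℝ) t :=
          fun r => (Subtype.mono_coe _).map_min
        simp only [Prod.snd_sub, Pi.sub_apply, Set.indicator, Set.mem_Ioc, hmin, le_min_iff,
          hs.1, hs.2, true_and, and_true]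
        by_cases h1 : s ≤ φ.time k.succ
        · by_cases h2 : s ≤ φ.time k.castSucc
          · simp [h1, h2, not_lt.2 h2]
          · simp [h1, h2, not_le.1 h2]
        · have h2 : ¬ s ≤ φ.time k.castSucc := fun h => h1 (h.trans hmono)
          simp [h1, h2]
      · dsimp only
        rw [Set.indicator_of_notMem hs]
        refine (Finset.sum_eq_zero fun k _ => ?_).symm
        have h1 : ∀ r : unitInterval, s ∉ Set.Ioc (0 : ℝ) (min r t : unitInterval) :=
          fun r hr => hs ⟨hr.1, hr.2.trans (by exact_mod_cast min_le_right r t)⟩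
        simp only [Prod.snd_sub, Pi.sub_apply]
        rw [Set.indicator_of_notMem (h1 _), Set.indicator_of_notMem (h1 _), sub_zero]
  rw [h]
  exact Submodule.sum_mem _ fun k _ =>
    Submodule.sub_mem _ (inner_mem_stepPairs B _ _) (inner_mem_stepPairs B _ _)

theorem sum_stepIntegral_mem_stepPairs (B : Ω → PathSpace l) (φ : MatrixStep l) {ι : Type*}
    [Fintype ι] (c : ι → EuclideanSpace ℝ (Fin l)) (a b : ι → unitInterval)
    (hab : ∀ p, a p ≤ b p) :
    ((fun ω => ∑ p, inner ℝ (c p) (φ.integral (B ω) (b p) - φ.integral (B ω) (a p))),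
      fun s => ∑ p, (Set.Ioc (a p : ℝ) (b p)).indicator
        (fun s => Matrix.toEuclideanLin (φ.eval s)ᵀ (c p)) s) ∈ stepPairs B := by
  have h := Submodule.sum_mem (stepPairs B) (t := Finset.univ) fun p _ =>
    Submodule.sub_mem _ (stepIntegral_mem_stepPairs B φ (c p) (b p))
      (stepIntegral_mem_stepPairs B φ (c p) (a p))
  convert h using 1
  refine Prod.ext ?_ ?_
  · rw [Prod.fst_sum]
    ext ω
    simp [inner_sub_right]
  · rw [Prod.snd_sum]
    ext1 s
    rw [Finset.sum_apply]
    refine Finset.sum_congr rfl fun p _ => ?_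
    have hab' : (a p : ℝ) ≤ b p := hab p
    have h0 : (0 : ℝ) ≤ a p := (a p).2.1
    simp only [Prod.snd_sub, Pi.sub_apply, Set.indicator, Set.mem_Ioc]
    by_cases h1 : s ≤ b p
    · by_cases h2 : s ≤ a p
      · simp [h1, h2, not_lt.2 h2]
      · simp [h1, h2, not_le.1 h2, h0.trans_lt (not_le.1 h2)]
    · have h2 : ¬ s ≤ a p := fun h => h1 (h.trans hab')
      simp [h1, h2]

end StepIntegral

/-- The increments of a Wiener integral are jointly Gaussian, with covariances given by the
Wiener isometry. -/
theorem IsWienerIntegral.map_sum_inner_increments {l : ℕ} {Ω : Type*} [MeasurableSpace Ω]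
    {P : Measure Ω} [IsProbabilityMeasure P] {K : ℝ → Matrix (Fin l) (Fin l) ℝ}
    {B M : Ω → PathSpace l} (hB : IsStandardBrownianMotion B P) (hM : IsWienerIntegral K B M P)
    (hK : ∀ i j, AEMeasurable (fun s => K s i j) (volume.restrict (Set.Icc (0 : ℝ) 1)))
    {ι : Type*} [Fintype ι] (c : ι → EuclideanSpace ℝ (Fin l)) (a b : ι → unitInterval)
    (hab : ∀ p, a p ≤ b p) :
    MemLp (fun s => ∑ p, (Set.Ioc (a p : ℝ) (b p)).indicator
        (fun s => Matrix.toEuclideanLin (K s)ᵀ (c p)) s) 2 (volume.restrict (Set.Icc (0 : ℝ) 1)) ∧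
    P.map (fun ω => ∑ p, inner ℝ (c p) (M ω (b p) - M ω (a p)))
      = gaussianReal 0 (∫ s in Set.Icc (0 : ℝ) 1,
        ‖∑ p, (Set.Ioc (a p : ℝ) (b p)).indicator
          (fun s => Matrix.toEuclideanLin (K s)ᵀ (c p)) s‖ ^ 2).toNNReal := by
  obtain ⟨φ, hφ, hI⟩ := hM.approx
  set ν : Measure ℝ := volume.restrict (Set.Icc (0 : ℝ) 1) with hν
  set ψ : ℝ → EuclideanSpace ℝ (Fin l) := fun s => ∑ p, (Set.Ioc (a p : ℝ) (b p)).indicator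
    (fun s => Matrix.toEuclideanLin (K s)ᵀ (c p)) s with hψ
  set ψn : ℕ → ℝ → EuclideanSpace ℝ (Fin l) := fun n s => ∑ p,
    (Set.Ioc (a p : ℝ) (b p)).indicator
      (fun s => Matrix.toEuclideanLin ((φ n).eval s)ᵀ (c p)) s with hψn
  set Y : Ω → ℝ := fun ω => ∑ p, inner ℝ (c p) (M ω (b p) - M ω (a p)) with hY
  set Yn : ℕ → Ω → ℝ := fun n ω => ∑ p,
    inner ℝ (c p) ((φ n).integral (B ω) (b p) - (φ n).integral (B ω) (a p)) with hYn
  have hmem : ∀ n, (Yn n, ψn n) ∈ stepPairs B := fun n =>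
    sum_stepIntegral_mem_stepPairs B (φ n) c a b hab
  have hYnm : ∀ n, Measurable (Yn n) := fun n =>
    (measurable_of_mem_stepPairs hB.measurable (hmem n)).1
  have hψnL : ∀ n, MemLp (ψn n) 2 ν := fun n =>
    (measurable_of_mem_stepPairs hB.measurable (hmem n)).2
  have hMm : ∀ t, Measurable fun ω => M ω t := fun t =>
    (measurable_path_eval t).comp hM.measurable
  have hYm : Measurable Y := Finset.measurable_fun_sum _ fun p _ =>
    Measurable.inner measurable_const ((hMm _).sub (hMm _))
  have hψm : AEStronglyMeasurable ψ ν := by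
    refine Finset.aestronglyMeasurable_fun_sum _ fun p _ => ?_
    exact (aestronglyMeasurable_toEuclideanLin hK (c p)).indicator measurableSet_Ioc
  have hφm : ∀ n i j, Measurable fun s => (φ n).eval s i j := by
    intro n i j
    simp only [MatrixStep.eval, Matrix.sum_apply]
    refine Finset.measurable_fun_sum _ fun k _ => ?_
    have : (fun s => (Set.Ioc ((φ n).time k.castSucc : ℝ) ((φ n).time k.succ)).indicator
        (fun _ => (φ n).value k) s i j)
        = (Set.Ioc ((φ n).time k.castSucc : ℝ) ((φ n).time k.succ)).indicator
          (fun _ => (φ n).value k i j) := by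
      ext s
      by_cases hs : s ∈ Set.Ioc ((φ n).time k.castSucc : ℝ) ((φ n).time k.succ) <;>
        simp [Set.indicator, hs]
    rw [this]
    exact measurable_const.indicator measurableSet_Ioc
  -- the integrands converge in `L²`
  have hψlim : Tendsto (fun n => eLpNorm (ψn n - ψ) 2 ν) atTop (𝓝 0) := by
    set bd : ι → Fin l → Fin l → ℕ → ℝ → ℝ := fun p i j n s =>
      ‖c p j‖ * ‖(φ n).eval s j i - K s j i‖ with hbd
    have hbdm : ∀ p i j n, AEStronglyMeasurable (bd p i j n) ν := fun p i j n =>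
      ((((hφm n j i).aemeasurable.sub (hK j i)).norm).const_mul _).aestronglyMeasurable
    have hle : ∀ n, eLpNorm (ψn n - ψ) 2 ν
        ≤ ∑ p, ∑ i, ∑ j, ‖c p j‖ₑ * eLpNorm (fun s => (φ n).eval s j i - K s j i) 2 ν := by
      intro n
      calc eLpNorm (ψn n - ψ) 2 ν ≤ eLpNorm (∑ p, ∑ i, ∑ j, bd p i j n) 2 ν := by
            refine eLpNorm_mono_real fun s => ?_
            simp only [hψn, hψ, Pi.sub_apply, ← Finset.sum_sub_distrib, Finset.sum_apply]
            refine (norm_sum_le _ _).trans (Finset.sum_le_sum fun p _ => ?_)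
            have h0 : 0 ≤ ∑ i, ∑ j, bd p i j n s :=
              Finset.sum_nonneg fun i _ => Finset.sum_nonneg fun j _ => by
                simp only [hbd]; positivity
            by_cases hs : s ∈ Set.Ioc (a p : ℝ) (b p)
            · rw [Set.indicator_of_mem hs, Set.indicator_of_mem hs, ← LinearMap.sub_apply,
                ← map_sub, ← Matrix.transpose_sub]
              exact norm_toEuclideanLin_transpose_le _ _
            · rw [Set.indicator_of_notMem hs, Set.indicator_of_notMem hs, sub_zero, norm_zero]
              exact h0
        _ ≤ ∑ p, ∑ i, ∑ j, eLpNorm (bd p i j n) 2 ν := by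
            refine (eLpNorm_sum_le (fun p _ => Finset.aestronglyMeasurable_sum _ fun i _ =>
              Finset.aestronglyMeasurable_sum _ fun j _ => hbdm p i j n) one_le_two).trans
              (Finset.sum_le_sum fun p _ => ?_)
            refine (eLpNorm_sum_le (fun i _ =>
              Finset.aestronglyMeasurable_sum _ fun j _ => hbdm p i j n) one_le_two).trans
              (Finset.sum_le_sum fun i _ => ?_)
            exact eLpNorm_sum_le (fun j _ => hbdm p i j n) one_le_two
        _ = _ := by
            refine Finset.sum_congr rfl fun p _ => Finset.sum_congr rfl fun i _ =>
              Finset.sum_congr rfl fun j _ => ?_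
            have : bd p i j n = ‖c p j‖ • fun s => ‖(φ n).eval s j i - K s j i‖ := rfl
            rw [this, eLpNorm_const_smul, eLpNorm_norm, enorm_norm]
    refine tendsto_of_tendsto_of_tendsto_of_le_of_le tendsto_const_nhds ?_
      (fun n => zero_le) hle
    rw [show (0 : ℝ≥0∞) = ∑ p, ∑ _i : Fin l, ∑ j, ‖c p j‖ₑ * 0 by simp]
    exact tendsto_finsetSum _ fun p _ => tendsto_finsetSum _ fun i _ => tendsto_finsetSum _
      fun j _ => ENNReal.Tendsto.const_mul (hφ j i) (Or.inr enorm_ne_top)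
  have hψL : MemLp ψ 2 ν := by
    obtain ⟨n, hn⟩ := (hψlim.eventually_lt_const (ENNReal.zero_lt_top)).exists
    have h1 : MemLp (ψn n - ψ) 2 ν := ⟨(hψnL n).1.sub hψm, hn⟩
    simpa using (hψnL n).sub h1
  -- the integrals converge in `L²`
  have hYlim : Tendsto (fun n => eLpNorm (Yn n - Y) 2 P) atTop (𝓝 0) := by
    have hIm : ∀ n t, Measurable fun ω => (φ n).integral (B ω) t := by
      intro n t
      simp only [MatrixStep.integral]
      refine Finset.measurable_fun_sum _ fun k _ => ?_
      have hc : Measurable (Matrix.toEuclideanLin ((φ n).value k)) :=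
        (LinearMap.continuous_of_finiteDimensional _).measurable
      exact hc.comp (((measurable_path_eval _).comp hB.measurable).sub
        ((measurable_path_eval _).comp hB.measurable))
    set D : ℕ → unitInterval → Ω → ℝ := fun n t ω => ‖(φ n).integral (B ω) t - M ω t‖ with hD
    have hDm : ∀ n t, Measurable (D n t) := fun n t => ((hIm n t).sub (hMm t)).norm
    have hle : ∀ n, eLpNorm (Yn n - Y) 2 P ≤ ∑ p, ‖c p‖ₑ *
        (eLpNorm (fun ω => (φ n).integral (B ω) (b p) - M ω (b p)) 2 P
          + eLpNorm (fun ω => (φ n).integral (B ω) (a p) - M ω (a p)) 2 P) := by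
      intro n
      calc eLpNorm (Yn n - Y) 2 P
          ≤ eLpNorm (∑ p, ‖c p‖ • (D n (b p) + D n (a p))) 2 P := by
            refine eLpNorm_mono_real fun ω => ?_
            simp only [hYn, hY, Pi.sub_apply, ← Finset.sum_sub_distrib, Finset.sum_apply]
            refine (norm_sum_le _ _).trans (Finset.sum_le_sum fun p _ => ?_)
            rw [← inner_sub_right]
            refine (norm_inner_le_norm _ _).trans ?_
            simp only [Pi.smul_apply, Pi.add_apply, smul_eq_mul, hD]
            refine mul_le_mul_of_nonneg_left ?_ (norm_nonneg _)
            rw [sub_sub_sub_comm]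
            exact norm_sub_le _ _
        _ ≤ ∑ p, eLpNorm (‖c p‖ • (D n (b p) + D n (a p))) 2 P :=
            eLpNorm_sum_le (fun p _ => (((hDm n _).add (hDm n _)).const_smul
              (‖c p‖)).aestronglyMeasurable) one_le_two
        _ ≤ _ := by
            refine Finset.sum_le_sum fun p _ => ?_
            rw [eLpNorm_const_smul, enorm_norm]
            gcongr
            refine (eLpNorm_add_le (hDm n _).aestronglyMeasurable
              (hDm n _).aestronglyMeasurable one_le_two).trans ?_
            simp only [hD, eLpNorm_norm]
            exact le_rfl
    refine tendsto_of_tendsto_of_tendsto_of_le_of_le tendsto_const_nhds ?_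
      (fun n => zero_le) hle
    rw [show (0 : ℝ≥0∞) = ∑ p, ‖c p‖ₑ * (0 + 0) by simp]
    exact tendsto_finsetSum _ fun p _ =>
      ENNReal.Tendsto.const_mul ((hI _).add (hI _)) (Or.inr enorm_ne_top)
  refine ⟨hψL, ?_⟩
  have hdist := (tendstoInMeasure_of_tendsto_eLpNorm two_ne_zero
    (fun n => (hYnm n).aestronglyMeasurable) hYm.aestronglyMeasurable
    hYlim).tendstoInDistribution fun n => (hYnm n).aemeasurable
  have hprob : IsProbabilityMeasure (P.map Y) := Measure.isProbabilityMeasure_map hYm.aemeasurable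
  refine Measure.ext_of_charFun (funext fun t => ?_)
  have hc1 := ProbabilityMeasure.tendsto_iff_tendsto_charFun.1 hdist.tendsto t
  have hlim := tendsto_integral_norm_sq hψnL hψL hψlim
  refine tendsto_nhds_unique hc1 ?_
  simp only [ProbabilityMeasure.coe_mk, hB.map_eq_of_mem_stepPairs (hmem _),
    charFun_gaussianReal]
  refine (Complex.continuous_exp.tendsto _).comp ?_
  refine tendsto_const_nhds.sub (Tendsto.div_const (Tendsto.mul_const _ ?_) _)
  exact (Complex.continuous_ofReal.tendsto _).comp
    ((NNReal.continuous_coe.tendsto _).comp ((continuous_real_toNNReal.tendsto _).comp hlim))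

/-! ### Grid increments in orthonormal bases -/

open scoped Matrix.Norms.L2Operator in
/-- The square root is continuous on the positive semidefinite matrices. The operator norm enters
the proof only: it induces the entrywise topology. -/
theorem continuousOn_matrix_sqrt (l : ℕ) :
    ContinuousOn (CFC.sqrt : Matrix (Fin l) (Fin l) ℝ → Matrix (Fin l) (Fin l) ℝ)
      {A | 0 ≤ A} := CFC.continuousOn_sqrt

theorem isClosed_setOf_posSemidef (l : ℕ) :
    IsClosed {A : Matrix (Fin l) (Fin l) ℝ | A.PosSemidef} := by
  have h : {A : Matrix (Fin l) (Fin l) ℝ | A.PosSemidef}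
      = {A | Aᴴ = A} ∩ ⋂ x : Fin l → ℝ, {A | 0 ≤ star x ⬝ᵥ (A *ᵥ x)} := by
    ext A
    simp only [Set.mem_ofPred_eq, Matrix.posSemidef_iff_dotProduct_mulVec, Matrix.IsHermitian,
      Set.mem_inter_iff, Set.mem_iInter]
  rw [h]
  refine IsClosed.inter (isClosed_eq continuous_id.matrix_conjTranspose continuous_id)
    (isClosed_iInter fun x => isClosed_le continuous_const ?_)
  exact continuous_const.dotProduct (continuous_id.matrix_mulVec continuous_const)

/-- Measurability of the square root of a positive semidefinite matrix-valued function, entry by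
entry. -/
theorem aemeasurable_matrix_sqrt {l : ℕ} {α : Type*} [MeasurableSpace α] {ν : Measure α}
    {G : α → Matrix (Fin l) (Fin l) ℝ} (hG : ∀ᵐ s ∂ν, (G s).PosSemidef)
    (hm : ∀ i j, AEMeasurable (fun s => G s i j) ν) (i j : Fin l) :
    AEMeasurable (fun s => CFC.sqrt (G s) i j) ν := by
  let mM : MeasurableSpace (Matrix (Fin l) (Fin l) ℝ) :=
    inferInstanceAs (MeasurableSpace (Fin l → Fin l → ℝ))
  have bM : BorelSpace (Matrix (Fin l) (Fin l) ℝ) :=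
    inferInstanceAs (BorelSpace (Fin l → Fin l → ℝ))
  have hGm : AEMeasurable G ν :=
    aemeasurable_pi_iff.2 fun i => aemeasurable_pi_iff.2 fun j => hm i j
  set C : Set (Matrix (Fin l) (Fin l) ℝ) := {A | A.PosSemidef} with hC
  have hCm : MeasurableSet C := (isClosed_setOf_posSemidef l).measurableSet
  have hcont : ContinuousOn (fun A : Matrix (Fin l) (Fin l) ℝ => CFC.sqrt A i j) C := by
    have h1 : ContinuousOn (CFC.sqrt : Matrix (Fin l) (Fin l) ℝ → _) C :=
      (continuousOn_matrix_sqrt l).mono fun A hA => Matrix.PosSemidef.nonneg hA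
    exact (continuous_id.matrix_elem i j).comp_continuousOn h1
  classical
  have hmeas : Measurable (C.piecewise (fun A => CFC.sqrt A i j) fun _ => 0) :=
    hcont.measurable_piecewise continuousOn_const hCm
  refine (hmeas.comp_aemeasurable hGm).congr ?_
  filter_upwards [hG] with s hs
  exact Set.piecewise_eq_of_mem _ _ _ hs

theorem sqrt_mul_transpose_sqrt {l : ℕ} {A : Matrix (Fin l) (Fin l) ℝ} (hA : A.PosSemidef) :
    CFC.sqrt A * (CFC.sqrt A)ᵀ = A := by
  have h : (CFC.sqrt A).PosSemidef := Matrix.nonneg_iff_posSemidef.1 (CFC.sqrt_nonneg A)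
  have h1 := h.1.eq
  rw [Matrix.conjTranspose_eq_transpose_of_trivial] at h1
  rw [h1, CFC.sqrt_mul_sqrt_self A hA.nonneg]

/-- Brownian motion is the Wiener integral of the identity matrix. -/
theorem IsStandardBrownianMotion.isWienerIntegral_one {l : ℕ} {Ω : Type*} [MeasurableSpace Ω]
    {P : Measure Ω} {B : Ω → PathSpace l} (hB : IsStandardBrownianMotion B P) :
    IsWienerIntegral (fun _ => 1) B B P where
  measurable := hB.measurable
  approx := by
    refine ⟨fun _ => ⟨1, ![0, 1], ?_, fun _ => 1⟩, fun i j => ?_, fun t => ?_⟩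
    · intro i j hij
      fin_cases i <;> fin_cases j <;> simp_all
    · refine tendsto_const_nhds.congr fun n => ?_
      symm
      rw [eLpNorm_congr_ae (g := fun _ => (0 : ℝ)), eLpNorm_zero']
      -- the step function vanishes at the left end point
      have h0 : ∀ᵐ s ∂(volume.restrict (Set.Icc (0 : ℝ) 1)), s ≠ 0 :=
        ae_restrict_of_ae (Measure.ae_ne volume 0)
      filter_upwards [h0, ae_restrict_mem measurableSet_Icc] with s hs0 hs
      have : s ∈ Set.Ioc (0 : ℝ) 1 := ⟨lt_of_le_of_ne hs.1 (Ne.symm hs0), hs.2⟩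
      change (∑ k : Fin 1, (Set.Ioc ((![0, 1] : Fin 2 → unitInterval) k.castSucc : ℝ)
        ((![0, 1] : Fin 2 → unitInterval) k.succ)).indicator
          (fun _ => (1 : Matrix (Fin l) (Fin l) ℝ)) s) i j - _ = 0
      rw [Fin.sum_univ_one, Set.indicator_of_mem (by simpa using this)]
      simp
    · refine tendsto_const_nhds.congr fun n => ?_
      symm
      rw [eLpNorm_congr_ae (g := fun _ => (0 : EuclideanSpace ℝ (Fin l))), eLpNorm_zero']
      filter_upwards [hB.start_zero] with ω hω
      have h1 : min (1 : unitInterval) t = t := min_eq_right unitInterval.le_one'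
      simp [MatrixStep.integral, h1, hω, Matrix.toEuclideanLin]

theorem IsWienerIntegral.start_zero {l : ℕ} {Ω : Type*} [MeasurableSpace Ω]
    {P : Measure Ω} {K : ℝ → Matrix (Fin l) (Fin l) ℝ} {B M : Ω → PathSpace l}
    (hM : IsWienerIntegral K B M P) : ∀ᵐ ω ∂P, M ω 0 = 0 := by
  obtain ⟨φ, -, h⟩ := hM.approx
  have h0 : ∀ n ω, (φ n).integral (B ω) 0 = 0 := by
    intro n ω
    simp [MatrixStep.integral]
  have h1 := h 0
  simp only [h0] at h1
  have h2 := tendsto_nhds_unique h1 tendsto_const_nhds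
  have hm : Measurable fun ω => M ω 0 := (measurable_path_eval 0).comp hM.measurable
  have h3 := (eLpNorm_eq_zero_iff (Measurable.const_sub hm 0).aestronglyMeasurable
    two_ne_zero).1 h2.symm
  filter_upwards [h3] with ω hω
  simpa using hω

/-- The interval `(k/n, (k+1)/n]`. -/
noncomputable def gridCell (n : ℕ) (k : Fin n) : Set ℝ :=
  Set.Ioc (gridPoint n k.castSucc : ℝ) (gridPoint n k.succ)

theorem gridCell_eq (n : ℕ) (k : Fin n) :
    gridCell n k = Set.Ioc ((k : ℝ) / n) (((k : ℝ) + 1) / n) := by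
  simp [gridCell, gridPoint]

theorem measurableSet_gridCell (n : ℕ) (k : Fin n) : MeasurableSet (gridCell n k) :=
  measurableSet_Ioc

theorem gridCell_subset (n : ℕ) (k : Fin n) : gridCell n k ⊆ Set.Icc 0 1 := fun _ hs =>
  ⟨(gridPoint n k.castSucc).2.1.trans hs.1.le, hs.2.trans (gridPoint n k.succ).2.2⟩

theorem gridPoint_castSucc_le (n : ℕ) (k : Fin n) :
    gridPoint n k.castSucc ≤ gridPoint n k.succ := by
  rw [← Subtype.coe_le_coe]
  simp only [gridPoint, Fin.val_castSucc, Fin.val_succ, Nat.cast_add, Nat.cast_one]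
  gcongr
  linarith

theorem mem_gridCell_iff {n : ℕ} (k : Fin n) (s : ℝ) :
    s ∈ gridCell n k ↔ ⌈(n : ℝ) * s⌉ = (k : ℤ) + 1 := by
  have hn : (0 : ℝ) < n := by exact_mod_cast k.pos
  rw [gridCell_eq, Int.ceil_eq_iff, Set.mem_Ioc, div_lt_iff₀ hn, le_div_iff₀ hn]
  push_cast
  rw [add_sub_cancel_right, mul_comm s]

theorem pairwise_disjoint_gridCell (n : ℕ) :
    Pairwise (Function.onFun Disjoint (gridCell n)) := by
  intro k k' hk
  refine Set.disjoint_left.2 fun s hs hs' => hk ?_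
  rw [mem_gridCell_iff] at hs hs'
  have := hs.symm.trans hs'
  ext
  omega

theorem iUnion_gridCell {n : ℕ} (hn : 1 ≤ n) : ⋃ k, gridCell n k = Set.Ioc 0 1 := by
  have hn' : (0 : ℝ) < n := by exact_mod_cast hn
  ext s
  simp only [Set.mem_iUnion, mem_gridCell_iff]
  constructor
  · rintro ⟨k, hk⟩
    rw [Int.ceil_eq_iff] at hk
    push_cast at hk
    have h1 : (0 : ℝ) ≤ k := by positivity
    have h2 : (k : ℝ) + 1 ≤ n := by exact_mod_cast k.2
    constructor
    · by_contra h
      nlinarith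
    · by_contra h
      nlinarith
  · intro hs
    have h1 : 0 < ⌈(n : ℝ) * s⌉ := Int.ceil_pos.2 (mul_pos hn' hs.1)
    have h2 : ⌈(n : ℝ) * s⌉ ≤ n := Int.ceil_le.2 (by push_cast; nlinarith [hs.2])
    refine ⟨⟨(⌈(n : ℝ) * s⌉ - 1).toNat, by omega⟩, ?_⟩
    simp only
    omega

theorem volume_real_gridCell (n : ℕ) (k : Fin n) : volume.real (gridCell n k) = 1 / n := by
  rw [gridCell_eq, Measure.real, Real.volume_Ioc, ← sub_div, add_sub_cancel_left,
    ENNReal.toReal_ofReal (by positivity)]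

/-- The covariance matrix `∫ G` over `(k/n, (k+1)/n]` of the `k`-th increment. -/
noncomputable def cellCov {l : ℕ} (G : ℝ → Matrix (Fin l) (Fin l) ℝ) (n : ℕ) (k : Fin n) :
    Matrix (Fin l) (Fin l) ℝ :=
  Matrix.of fun i j => ∫ s in gridCell n k, G s i j

/-- The coordinates of the grid increments of a path with respect to a choice of basis for each
increment. -/
noncomputable def gridIncr {l n : ℕ}
    (u : Fin n → OrthonormalBasis (Fin l) ℝ (EuclideanSpace ℝ (Fin l)))
    (ω : PathSpace l) (p : Fin n × Fin l) : ℝ :=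
  inner ℝ (u p.1 p.2) (ω (gridPoint n p.1.succ) - ω (gridPoint n p.1.castSucc))

theorem norm_sq_toEuclideanLin_transpose {l : ℕ} (A : Matrix (Fin l) (Fin l) ℝ)
    (c : EuclideanSpace ℝ (Fin l)) :
    ‖Matrix.toEuclideanLin Aᵀ c‖ ^ 2 = c.ofLp ⬝ᵥ ((A * Aᵀ) *ᵥ c.ofLp) := by
  rw [← real_inner_self_eq_norm_sq, ← inner_toEuclideanLin, EuclideanSpace.inner_eq_star_dotProduct,
    dotProduct_comm, ← Matrix.mulVec_mulVec]
  simp [Matrix.toEuclideanLin]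

theorem dotProduct_mulVec_sum_eigenbasis {l : ℕ} {S : Matrix (Fin l) (Fin l) ℝ}
    (u : OrthonormalBasis (Fin l) ℝ (EuclideanSpace ℝ (Fin l))) (v : Fin l → ℝ)
    (hS : ∀ i, S *ᵥ (u i).ofLp = v i • (u i).ofLp) (t : Fin l → ℝ) :
    (∑ i, t i • u i).ofLp ⬝ᵥ (S *ᵥ (∑ i, t i • u i).ofLp) = ∑ i, v i * t i ^ 2 := by
  have h1 : (WithLp.toLp 2 (S *ᵥ (∑ i, t i • u i).ofLp) : EuclideanSpace ℝ (Fin l))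
      = ∑ i, (t i * v i) • u i := by
    have : (WithLp.toLp 2 (S *ᵥ (∑ i, t i • u i).ofLp) : EuclideanSpace ℝ (Fin l))
        = Matrix.toEuclideanLin S (∑ i, t i • u i) := rfl
    rw [this, map_sum]
    refine Finset.sum_congr rfl fun i _ => ?_
    rw [map_smul, mul_smul]
    congr 1
    ext j
    exact congrFun (hS i) j
  have h2 : (∑ i, t i • u i).ofLp ⬝ᵥ (S *ᵥ (∑ i, t i • u i).ofLp)
      = inner ℝ (∑ i, t i • u i)
        (WithLp.toLp 2 (S *ᵥ (∑ i, t i • u i).ofLp) : EuclideanSpace ℝ (Fin l)) := by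
    rw [EuclideanSpace.inner_eq_star_dotProduct, dotProduct_comm]
    simp
  rw [h2, h1, u.orthonormal.inner_sum]
  refine Finset.sum_congr rfl fun i _ => ?_
  simp
  ring

theorem measurable_gridIncr {l n : ℕ}
    (u : Fin n → OrthonormalBasis (Fin l) ℝ (EuclideanSpace ℝ (Fin l))) :
    Measurable (gridIncr u) :=
  measurable_pi_lambda _ fun _ =>
    Measurable.inner measurable_const ((measurable_path_eval _).sub (measurable_path_eval _))

/-- In a basis that diagonalizes the covariance matrix of each increment, the coordinates of the
grid increments of a Wiener integral are independent centered Gaussian variables. -/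
theorem IsWienerIntegral.map_gridIncr {l : ℕ} {Ω : Type*} [MeasurableSpace Ω]
    {P : Measure Ω} [IsProbabilityMeasure P] {K G : ℝ → Matrix (Fin l) (Fin l) ℝ}
    {B M : Ω → PathSpace l} (hB : IsStandardBrownianMotion B P) (hM : IsWienerIntegral K B M P)
    (hK : ∀ i j, AEMeasurable (fun s => K s i j) (volume.restrict (Set.Icc (0 : ℝ) 1)))
    (hKG : ∀ s ∈ Set.Icc (0 : ℝ) 1, K s * (K s)ᵀ = G s)
    (hG : ∀ i j, IntegrableOn (fun s => G s i j) (Set.Icc (0 : ℝ) 1))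
    {n : ℕ} (u : Fin n → OrthonormalBasis (Fin l) ℝ (EuclideanSpace ℝ (Fin l)))
    (v : Fin n × Fin l → NNReal)
    (hv : ∀ k i, cellCov G n k *ᵥ (u k i).ofLp = (v (k, i) : ℝ) • (u k i).ofLp) :
    (P.map M).map (gridIncr u) = Measure.pi fun p => gaussianReal 0 (v p) := by
  rw [Measure.map_map (measurable_gridIncr u) hM.measurable]
  have hTm : Measurable (gridIncr u ∘ M) := (measurable_gridIncr u).comp hM.measurable
  have := Measure.isProbabilityMeasure_map (μ := P) hTm.aemeasurable
  refine charFun_eq_pi_iff.1 fun t => ?_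
  set c : Fin n → EuclideanSpace ℝ (Fin l) := fun k => ∑ i, t (k, i) • u k i with hc
  obtain ⟨-, hlaw⟩ := hM.map_sum_inner_increments hB hK c
    (fun k => gridPoint n k.castSucc) (fun k => gridPoint n k.succ) (gridPoint_castSucc_le n)
  have hY : ∀ ω, inner ℝ (WithLp.toLp 2 ((gridIncr u ∘ M) ω)) t
      = ∑ k, inner ℝ (c k) (M ω (gridPoint n k.succ) - M ω (gridPoint n k.castSucc)) := by
    intro ω
    rw [PiLp.inner_apply, Fintype.sum_prod_type]
    refine Finset.sum_congr rfl fun k _ => ?_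
    rw [hc, sum_inner]
    refine Finset.sum_congr rfl fun i _ => ?_
    simp [gridIncr, inner_smul_left]
  have hvar : (∫ s in Set.Icc (0 : ℝ) 1,
      ‖∑ k, (Set.Ioc (gridPoint n k.castSucc : ℝ) (gridPoint n k.succ)).indicator
        (fun s => Matrix.toEuclideanLin (K s)ᵀ (c k)) s‖ ^ 2) = ∑ p, v p * t p ^ 2 := by
    have hGk : ∀ k i j, IntegrableOn (fun s => G s i j) (gridCell n k) := fun k i j =>
      (hG i j).mono_set (gridCell_subset n k)
    have h1 : ∀ s ∈ Set.Icc (0 : ℝ) 1,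
        ‖∑ k, (Set.Ioc (gridPoint n k.castSucc : ℝ) (gridPoint n k.succ)).indicator
        (fun s => Matrix.toEuclideanLin (K s)ᵀ (c k)) s‖ ^ 2
        = ∑ k, (gridCell n k).indicator (fun s => (c k).ofLp ⬝ᵥ (G s *ᵥ (c k).ofLp)) s := by
      intro s hs
      change ‖∑ k, (gridCell n k).indicator _ s‖ ^ 2 = _
      by_cases hk : ∃ k, s ∈ gridCell n k
      · obtain ⟨k, hk⟩ := hk
        have hne : ∀ k', k' ≠ k → s ∉ gridCell n k' := fun k' hk' hs' =>
          Set.disjoint_left.1 (pairwise_disjoint_gridCell n hk') hs' hk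
        rw [Finset.sum_eq_single k (fun k' _ h => Set.indicator_of_notMem (hne k' h) _)
            (by simp),
          Finset.sum_eq_single k (fun k' _ h => Set.indicator_of_notMem (hne k' h) _)
            (by simp), Set.indicator_of_mem hk, Set.indicator_of_mem hk,
          norm_sq_toEuclideanLin_transpose, hKG s hs]
      · push Not at hk
        rw [Finset.sum_eq_zero fun k _ => Set.indicator_of_notMem (hk k) _,
          Finset.sum_eq_zero fun k _ => Set.indicator_of_notMem (hk k) _]
        simp
    rw [setIntegral_congr_fun measurableSet_Icc h1, integral_finsetSum, Fintype.sum_prod_type]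
    · refine Finset.sum_congr rfl fun k _ => ?_
      rw [setIntegral_indicator (measurableSet_gridCell n k),
        Set.inter_eq_right.2 (gridCell_subset n k),
        ← (dotProduct_mulVec_integral (hGk k) (c k).ofLp).2]
      exact dotProduct_mulVec_sum_eigenbasis (u k) (fun i => (v (k, i) : ℝ)) (hv k) _
    · intro k _
      exact (IntegrableOn.integrable_indicator
        (dotProduct_mulVec_integral (hGk k) (c k).ofLp).1 (measurableSet_gridCell n k)).restrict
  have hYm : Measurable fun ω =>
      ∑ k, inner ℝ (c k) (M ω (gridPoint n k.succ) - M ω (gridPoint n k.castSucc)) :=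
    Finset.measurable_fun_sum _ fun k _ => Measurable.inner measurable_const
      (((measurable_path_eval _).comp hM.measurable).sub
        ((measurable_path_eval _).comp hM.measurable))
  have hchar : charFun (((P.map (gridIncr u ∘ M))).map (WithLp.toLp 2)) t
      = charFun (P.map fun ω =>
        ∑ k, inner ℝ (c k) (M ω (gridPoint n k.succ) - M ω (gridPoint n k.castSucc))) 1 := by
    rw [charFun_apply, charFun_apply, Measure.map_map (by fun_prop) hTm,
      integral_map ((WithLp.measurable_toLp 2 _).comp hTm).aemeasurable (by fun_prop),
      integral_map hYm.aemeasurable (by fun_prop)]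
    refine integral_congr_ae (Eventually.of_forall fun ω => ?_)
    simp only [Function.comp_apply] at hY ⊢
    rw [hY]
    simp
  rw [hchar, hlaw, hvar, charFun_gaussianReal]
  simp only [charFun_gaussianReal]
  rw [← Complex.exp_sum]
  congr 1
  rw [Real.coe_toNNReal _ (Finset.sum_nonneg fun p _ => by positivity)]
  simp [Finset.sum_div]

/-! ### Densities and entropy of products of centered Gaussian measures on the grid -/

/-- The density of a product measure with respect to another is the product of the densities. -/
theorem pi_eq_withDensity_prod {ι : Type*} [Fintype ι] {X : ι → Type*}
    [∀ i, MeasurableSpace (X i)] {μ ν : ∀ i, Measure (X i)} [∀ i, IsProbabilityMeasure (μ i)]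
    [∀ i, IsProbabilityMeasure (ν i)] {f : ∀ i, X i → ℝ≥0∞} (hf : ∀ i, Measurable (f i))
    (h : ∀ i, μ i = (ν i).withDensity (f i)) :
    Measure.pi μ = (Measure.pi ν).withDensity fun x => ∏ i, f i (x i) := by
  refine Measure.pi_eq fun s hs => ?_
  have hind : ∀ i, Measurable ((s i).indicator (f i)) := fun i => (hf i).indicator (hs i)
  have hrect : ∀ x : ∀ i, X i, (Set.univ.pi s).indicator (fun x => ∏ i, f i (x i)) x
      = ∏ i, (s i).indicator (f i) (x i) := by
    intro x
    by_cases hx : x ∈ Set.univ.pi s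
    · rw [Set.indicator_of_mem hx]
      exact Finset.prod_congr rfl fun i _ => (Set.indicator_of_mem (hx i trivial) _).symm
    · rw [Set.indicator_of_notMem hx]
      simp only [Set.mem_univ_pi, not_forall] at hx
      obtain ⟨i, hi⟩ := hx
      exact (Finset.prod_eq_zero (Finset.mem_univ i) (Set.indicator_of_notMem hi _)).symm
  have hX : iIndepFun (fun i (x : ∀ i, X i) => (s i).indicator (f i) (x i)) (Measure.pi ν) :=
    iIndepFun_pi fun i => (hind i).aemeasurable
  rw [withDensity_apply _ (MeasurableSet.univ_pi hs), ← lintegral_indicator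
    (MeasurableSet.univ_pi hs), lintegral_congr hrect,
    lintegral_prod_eq_prod_lintegral_of_indepFun _ _ hX
      fun i => (hind i).comp (measurable_pi_apply i)]
  refine Finset.prod_congr rfl fun i _ => ?_
  rw [h i, withDensity_apply _ (hs i), ← lintegral_indicator (hs i)]
  exact (measurePreserving_eval ν i).lintegral_comp (hind i)

/-- The logarithm of the density of `N(0, v)` with respect to `N(0, w)`. -/
noncomputable def gaussianLogRatio (v w : NNReal) (x : ℝ) : ℝ :=
  1 / 2 * (((v : ℝ) / w - 1 - Real.log ((v : ℝ) / w)) + (1 / (w : ℝ) - 1 / v) * (x ^ 2 - v))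

theorem measurable_gaussianLogRatio (v w : NNReal) : Measurable (gaussianLogRatio v w) := by
  unfold gaussianLogRatio
  fun_prop

theorem gaussianReal_eq_withDensity {v w : NNReal} (hv : v ≠ 0) (hw : w ≠ 0) :
    gaussianReal 0 v = (gaussianReal 0 w).withDensity
      fun x => ENNReal.ofReal (Real.exp (gaussianLogRatio v w x)) := by
  have hv' : (0 : ℝ) < v := by exact_mod_cast pos_iff_ne_zero.2 hv
  have hw' : (0 : ℝ) < w := by exact_mod_cast pos_iff_ne_zero.2 hw
  rw [gaussianReal_of_var_ne_zero 0 hv, gaussianReal_of_var_ne_zero 0 hw,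
    ← withDensity_mul _ (measurable_gaussianPDF 0 w)
      (measurable_gaussianLogRatio v w).exp.ennreal_ofReal]
  congr 1
  ext x
  simp only [gaussianPDF, Pi.mul_apply]
  rw [← ENNReal.ofReal_mul (gaussianPDFReal_nonneg _ _ _)]
  congr 1
  have h1 : ∀ u : ℝ, 0 < u → (√(2 * Real.pi * u))⁻¹
      = (√(2 * Real.pi))⁻¹ * Real.exp (-(1 / 2) * Real.log u) := by
    intro u hu
    rw [Real.sqrt_mul (by positivity), mul_inv, Real.sqrt_eq_rpow u,
      Real.rpow_def_of_pos hu, ← Real.exp_neg]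
    ring_nf
  rw [gaussianPDFReal, gaussianPDFReal, h1 v hv', h1 w hw', mul_assoc, mul_assoc, mul_assoc,
    ← Real.exp_add, ← Real.exp_add, ← Real.exp_add]
  congr 2
  rw [gaussianLogRatio, Real.log_div hv'.ne' hw'.ne']
  field_simp
  ring

theorem memLp_sq_gaussianReal (v : NNReal) : MemLp (fun x : ℝ => x ^ 2) 2 (gaussianReal 0 v) := by
  have h := (memLp_id_gaussianReal' (μ := 0) (v := v) 4 (by simp)).norm_rpow_div 2
  have h4 : (4 : ℝ≥0∞) / 2 = 2 := by
    rw [show (4 : ℝ≥0∞) = 2 * 2 by norm_num, ENNReal.mul_div_cancel_right] <;> simp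
  rw [h4] at h
  simpa using h

theorem gaussianLogRatio_eq (v w : NNReal) : gaussianLogRatio v w = fun x =>
    (1 / 2 * (1 / (w : ℝ) - 1 / v)) * x ^ 2 - (1 / 2 * (1 / (w : ℝ) - 1 / v) * v
      - 1 / 2 * ((v : ℝ) / w - 1 - Real.log ((v : ℝ) / w))) := by
  ext x
  simp only [gaussianLogRatio]
  ring

theorem memLp_gaussianLogRatio (v w : NNReal) :
    MemLp (gaussianLogRatio v w) 2 (gaussianReal 0 v) := by
  rw [gaussianLogRatio_eq]
  exact ((memLp_sq_gaussianReal v).const_mul _).sub (memLp_const _)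

theorem integral_sq_gaussianReal (v : NNReal) : ∫ x, x ^ 2 ∂gaussianReal 0 v = v := by
  have h := variance_fun_id_gaussianReal (μ := 0) (v := v)
  rw [variance_eq_integral (by fun_prop), integral_id_gaussianReal] at h
  simpa using h

theorem integral_gaussianLogRatio (v w : NNReal) :
    ∫ x, gaussianLogRatio v w x ∂gaussianReal 0 v
      = 1 / 2 * ((v : ℝ) / w - 1 - Real.log ((v : ℝ) / w)) := by
  have h1 : Integrable (fun x : ℝ => x ^ 2) (gaussianReal 0 v) :=
    (memLp_sq_gaussianReal v).integrable one_le_two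
  have h2 : Integrable (fun x : ℝ => x ^ 2 - (v : ℝ)) (gaussianReal 0 v) :=
    h1.sub (integrable_const _)
  simp only [gaussianLogRatio]
  rw [integral_const_mul, integral_add (integrable_const _) (h2.const_mul _),
    integral_const_mul, integral_sub h1 (integrable_const _), integral_sq_gaussianReal]
  simp

theorem variance_sq_gaussianReal (v : NNReal) :
    Var[fun x => x ^ 2; gaussianReal 0 v]
      = (v : ℝ) ^ 2 * Var[fun x => x ^ 2; gaussianReal 0 1] := by
  have h : gaussianReal 0 v = (gaussianReal 0 1).map fun x => √(v : ℝ) * x := by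
    rw [gaussianReal_map_const_mul]
    congr 1
    · simp
    · ext
      simp
  rw [h, variance_map (by fun_prop) (by fun_prop)]
  have : (fun x : ℝ => x ^ 2) ∘ (fun x => √(v : ℝ) * x) = fun x => (v : ℝ) * x ^ 2 := by
    ext x
    simp [mul_pow]
  rw [this, variance_const_mul]

/-- The variance under `N(0, v)` of `log (dN(0, v)/dN(0, w))`. The variance of the square of a
standard Gaussian variable is left unevaluated, since only its finiteness matters. -/
theorem variance_gaussianLogRatio {v w : NNReal} (hv : v ≠ 0) :
    Var[gaussianLogRatio v w; gaussianReal 0 v]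
      = 1 / 4 * Var[fun x => x ^ 2; gaussianReal 0 1] * ((v : ℝ) / w - 1) ^ 2 := by
  have hv' : (v : ℝ) ≠ 0 := by exact_mod_cast hv
  rw [gaussianLogRatio_eq, variance_sub_const (by fun_prop), variance_const_mul,
    variance_sq_gaussianReal]
  field_simp
  ring

section Grid

variable {l n : ℕ} {u : Fin n → OrthonormalBasis (Fin l) ℝ (EuclideanSpace ℝ (Fin l))}

theorem measurable_gridSigma_eval (l n : ℕ) (k : Fin (n + 1)) :
    Measurable[gridSigma l n] (fun ω : PathSpace l => ω (gridPoint n k)) :=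
  (comap_measurable (fun ω : PathSpace l => ω (gridPoint n k))).mono
    (le_iSup (fun k : Fin (n + 1) => MeasurableSpace.comap
      (fun ω : PathSpace l => ω (gridPoint n k)) inferInstance) k) le_rfl

theorem measurable_gridSigma_gridIncr :
    Measurable[gridSigma l n] (gridIncr u) := by
  let := gridSigma l n
  exact measurable_pi_lambda _ fun p => Measurable.inner measurable_const
    ((measurable_gridSigma_eval l n _).sub (measurable_gridSigma_eval l n _))

theorem gridPoint_zero (n : ℕ) : gridPoint n 0 = 0 := by
  ext
  simp [gridPoint]

/-- A path that starts at `0` is determined on the grid by its increments. -/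
theorem eval_gridPoint_eq_sum {ω : PathSpace l} (h0 : ω 0 = 0) (k : Fin (n + 1)) :
    ω (gridPoint n k)
      = ∑ j : Fin n with j.castSucc < k, ∑ i, gridIncr u ω (j, i) • u j i := by
  induction k using Fin.induction with
  | zero => simp [gridPoint_zero, h0]
  | succ k ih =>
    have hset : (Finset.univ.filter fun j : Fin n => j.castSucc < k.succ)
        = insert k (Finset.univ.filter fun j : Fin n => j.castSucc < k.castSucc) := by
      ext j
      simp only [Finset.mem_filter, Finset.mem_univ, true_and, Finset.mem_insert,
        Fin.lt_def, Fin.val_castSucc, Fin.val_succ, Fin.ext_iff]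
      omega
    rw [hset, Finset.sum_insert (by simp), ← ih]
    have := (u k).sum_repr' (ω (gridPoint n k.succ) - ω (gridPoint n k.castSucc))
    simp only [gridIncr]
    rw [this, sub_add_cancel]

/-- Up to the event that the path does not start at `0`, the grid increments generate `𝓕ⁿ`. -/
theorem exists_measurableSet_gridIncr (u : Fin n → OrthonormalBasis (Fin l) ℝ
    (EuclideanSpace ℝ (Fin l))) {A : Set (PathSpace l)} (hA : MeasurableSet[gridSigma l n] A) :
    ∃ S : Set (Fin n × Fin l → ℝ), MeasurableSet S ∧
      ∀ ω : PathSpace l, ω 0 = 0 → (ω ∈ A ↔ gridIncr u ω ∈ S) := by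
  have hcomap : gridSigma l n = MeasurableSpace.comap
      (fun (ω : PathSpace l) (k : Fin (n + 1)) => ω (gridPoint n k)) MeasurableSpace.pi := by
    rw [MeasurableSpace.pi, MeasurableSpace.comap_iSup]
    simp only [MeasurableSpace.comap_comp]
    rfl
  rw [hcomap] at hA
  obtain ⟨S, hS, rfl⟩ := hA
  refine ⟨(fun y k => ∑ j : Fin n with j.castSucc < k, ∑ i, y (j, i) • u j i) ⁻¹' S,
    ?_, fun ω hω => ?_⟩
  · refine measurableSet_preimage ?_ hS
    refine measurable_pi_lambda _ fun k => Finset.measurable_fun_sum _ fun j _ =>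
      Finset.measurable_fun_sum _ fun i _ => (measurable_pi_apply _).smul_const _
  · have : (fun k => ω (gridPoint n k))
        = fun k => ∑ j : Fin n with j.castSucc < k, ∑ i, gridIncr u ω (j, i) • u j i :=
      funext fun k => eval_gridPoint_eq_sum hω k
    simp only [Set.mem_preimage, this]

/-- The log-density of the grid increments, as a function on path space. -/
noncomputable def gridGaussianLogRatio
    (u : Fin n → OrthonormalBasis (Fin l) ℝ (EuclideanSpace ℝ (Fin l)))
    (v w : Fin n × Fin l → NNReal) (ω : PathSpace l) : ℝ :=
  ∑ p, gaussianLogRatio (v p) (w p) (gridIncr u ω p)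

theorem measurable_gridGaussianLogRatio (v w : Fin n × Fin l → NNReal) :
    Measurable[gridSigma l n] (gridGaussianLogRatio u v w) := by
  let := gridSigma l n
  exact Finset.measurable_fun_sum _ fun p _ => (measurable_gaussianLogRatio _ _).comp
    ((measurable_pi_apply p).comp measurable_gridSigma_gridIncr)

variable {Q P : Measure (PathSpace l)} {v w : Fin n × Fin l → NNReal}

/-- Measures on path space under which the grid increments are independent centered Gaussian
variables have the Gaussian density ratio on `𝓕ⁿ`. -/
theorem gridRestrict_eq_withDensity
    (hQ0 : ∀ᵐ ω ∂Q, ω 0 = 0) (hP0 : ∀ᵐ ω ∂P, ω 0 = 0)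
    (hQ : Q.map (gridIncr u) = Measure.pi fun p => gaussianReal 0 (v p))
    (hP : P.map (gridIncr u) = Measure.pi fun p => gaussianReal 0 (w p))
    (hv : ∀ p, v p ≠ 0) (hw : ∀ p, w p ≠ 0) :
    gridRestrict n Q = (gridRestrict n P).withDensity
      fun ω => ENNReal.ofReal (Real.exp (gridGaussianLogRatio u v w ω)) := by
  set D : (Fin n × Fin l → ℝ) → ℝ≥0∞ :=
    fun x => ∏ p, ENNReal.ofReal (Real.exp (gaussianLogRatio (v p) (w p) (x p))) with hD
  have hDm : Measurable D := Finset.measurable_fun_prod _ fun p _ =>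
    ((measurable_gaussianLogRatio _ _).comp (measurable_pi_apply p)).exp.ennreal_ofReal
  have hDe : ∀ ω, ENNReal.ofReal (Real.exp (gridGaussianLogRatio u v w ω))
      = D (gridIncr u ω) := by
    intro ω
    rw [gridGaussianLogRatio, Real.exp_sum, ENNReal.ofReal_prod_of_nonneg fun _ _ =>
      (Real.exp_pos _).le]
  have hpi := pi_eq_withDensity_prod (fun p => (measurable_gaussianLogRatio (v p)
    (w p)).exp.ennreal_ofReal) fun p => gaussianReal_eq_withDensity (hv p) (hw p)
  refine @Measure.ext _ (gridSigma l n) _ _ fun A hA => ?_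
  obtain ⟨S, hS, hAS⟩ := exists_measurableSet_gridIncr u hA
  rw [gridRestrict, trim_measurableSet_eq _ hA, withDensity_apply _ hA, gridRestrict,
    restrict_trim _ _ hA, lintegral_trim _
      ((measurable_gridGaussianLogRatio v w).exp.ennreal_ofReal)]
  have h1 : Q A = Q (gridIncr u ⁻¹' S) := measure_congr <| by
    filter_upwards [hQ0] with ω hω using propext (hAS ω hω)
  have h2 : P.restrict A = P.restrict (gridIncr u ⁻¹' S) := Measure.restrict_congr_set <| by
    filter_upwards [hP0] with ω hω using propext (hAS ω hω)
  rw [h1, h2, ← Measure.map_apply (measurable_gridIncr u) hS, hQ, hpi, withDensity_apply _ hS,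
    ← hP, setLIntegral_map hS hDm (measurable_gridIncr u)]
  simp_rw [hDe]

theorem gridRestrict_absolutelyContinuous
    (hQ0 : ∀ᵐ ω ∂Q, ω 0 = 0) (hP0 : ∀ᵐ ω ∂P, ω 0 = 0)
    (hQ : Q.map (gridIncr u) = Measure.pi fun p => gaussianReal 0 (v p))
    (hP : P.map (gridIncr u) = Measure.pi fun p => gaussianReal 0 (w p))
    (hv : ∀ p, v p ≠ 0) (hw : ∀ p, w p ≠ 0) :
    gridRestrict n Q ≪ gridRestrict n P := by
  rw [gridRestrict_eq_withDensity hQ0 hP0 hQ hP hv hw]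
  exact withDensity_absolutelyContinuous _ _

theorem gridLogDensity_ae_eq [IsFiniteMeasure P]
    (hQ0 : ∀ᵐ ω ∂Q, ω 0 = 0) (hP0 : ∀ᵐ ω ∂P, ω 0 = 0)
    (hQ : Q.map (gridIncr u) = Measure.pi fun p => gaussianReal 0 (v p))
    (hP : P.map (gridIncr u) = Measure.pi fun p => gaussianReal 0 (w p))
    (hv : ∀ p, v p ≠ 0) (hw : ∀ p, w p ≠ 0) :
    gridLogDensity n Q P =ᵐ[gridRestrict n Q] gridGaussianLogRatio u v w := by
  have hac := gridRestrict_absolutelyContinuous hQ0 hP0 hQ hP hv hw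
  have : SigmaFinite (gridRestrict n P) :=
    inferInstanceAs (SigmaFinite (P.trim (gridSigma_le l n)))
  have h := @Measure.rnDeriv_withDensity _ (gridSigma l n) (gridRestrict n P) _ _
    ((measurable_gridGaussianLogRatio (u := u) v w).exp.ennreal_ofReal)
  rw [← gridRestrict_eq_withDensity hQ0 hP0 hQ hP hv hw] at h
  filter_upwards [hac.ae_le h] with ω hω
  rw [gridLogDensity, llr, hω, ENNReal.toReal_ofReal (Real.exp_pos _).le, Real.log_exp]

theorem memLp_gridGaussianLogRatio
    (hQ : Q.map (gridIncr u) = Measure.pi fun p => gaussianReal 0 (v p)) :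
    MemLp (gridGaussianLogRatio u v w) 2 Q := by
  have h : MemLp (fun x : Fin n × Fin l → ℝ => ∑ p, gaussianLogRatio (v p) (w p) (x p)) 2
      (Measure.pi fun p => gaussianReal 0 (v p)) :=
    memLp_finsetSum _ fun p _ => (memLp_gaussianLogRatio (v p) (w p)).comp_measurePreserving
      (measurePreserving_eval _ p)
  exact h.comp_measurePreserving ⟨measurable_gridIncr u, hQ⟩

theorem integral_gridGaussianLogRatio
    (hQ : Q.map (gridIncr u) = Measure.pi fun p => gaussianReal 0 (v p)) :
    ∫ ω, gridGaussianLogRatio u v w ω ∂Q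
      = ∑ p, 1 / 2 * ((v p : ℝ) / w p - 1 - Real.log ((v p : ℝ) / w p)) := by
  have h1 : ∫ ω, gridGaussianLogRatio u v w ω ∂Q
      = ∫ x, ∑ p, gaussianLogRatio (v p) (w p) (x p) ∂(Q.map (gridIncr u)) := by
    rw [integral_map (measurable_gridIncr u).aemeasurable]
    · rfl
    · exact (Finset.measurable_fun_sum _ fun p _ => (measurable_gaussianLogRatio _ _).comp
        (measurable_pi_apply p)).aestronglyMeasurable
  have h2 : ∀ p, Integrable (fun x : Fin n × Fin l → ℝ => gaussianLogRatio (v p) (w p) (x p))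
      (Measure.pi fun p => gaussianReal 0 (v p)) := fun p =>
    ((memLp_gaussianLogRatio (v p) (w p)).comp_measurePreserving
      (measurePreserving_eval (fun p => gaussianReal 0 (v p)) p)).integrable one_le_two
  rw [h1, hQ, integral_finsetSum _ fun p _ => h2 p]
  refine Finset.sum_congr rfl fun p _ => ?_
  rw [← integral_gaussianLogRatio]
  exact integral_comp_eval (X := fun _ : Fin n × Fin l => ℝ) (i := p)
    (f := gaussianLogRatio (v p) (w p)) (measurable_gaussianLogRatio _ _).aestronglyMeasurable

theorem variance_gridGaussianLogRatio
    (hQ : Q.map (gridIncr u) = Measure.pi fun p => gaussianReal 0 (v p))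
    (hv : ∀ p, v p ≠ 0) :
    Var[gridGaussianLogRatio u v w; Q]
      = 1 / 4 * Var[fun x => x ^ 2; gaussianReal 0 1] * ∑ p, ((v p : ℝ) / w p - 1) ^ 2 := by
  have hm : Measurable
      (∑ p, fun x : Fin n × Fin l → ℝ => gaussianLogRatio (v p) (w p) (x p)) := by
    rw [Finset.sum_fn]
    exact Finset.measurable_fun_sum _ fun p _ => (measurable_gaussianLogRatio _ _).comp
      (measurable_pi_apply p)
  have h1 : gridGaussianLogRatio u v w
      = (∑ p, fun x : Fin n × Fin l → ℝ => gaussianLogRatio (v p) (w p) (x p)) ∘ gridIncr u := by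
    ext ω
    simp [gridGaussianLogRatio]
  rw [h1, ← variance_map hm.aemeasurable (measurable_gridIncr u).aemeasurable, hQ,
    variance_sum_pi fun p => memLp_gaussianLogRatio (v p) (w p), Finset.mul_sum]
  exact Finset.sum_congr rfl fun p _ => variance_gaussianLogRatio (hv p)

theorem gridEntropy_eq_ofReal [IsProbabilityMeasure Q] [IsProbabilityMeasure P]
    (hQ0 : ∀ᵐ ω ∂Q, ω 0 = 0) (hP0 : ∀ᵐ ω ∂P, ω 0 = 0)
    (hQ : Q.map (gridIncr u) = Measure.pi fun p => gaussianReal 0 (v p))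
    (hP : P.map (gridIncr u) = Measure.pi fun p => gaussianReal 0 (w p))
    (hv : ∀ p, v p ≠ 0) (hw : ∀ p, w p ≠ 0) :
    gridEntropy n Q P = ENNReal.ofReal
      (∑ p, 1 / 2 * ((v p : ℝ) / w p - 1 - Real.log ((v p : ℝ) / w p))) := by
  have hac := gridRestrict_absolutelyContinuous hQ0 hP0 hQ hP hv hw
  have hae := gridLogDensity_ae_eq hQ0 hP0 hQ hP hv hw
  have hsm : StronglyMeasurable[gridSigma l n] (gridGaussianLogRatio u v w) :=
    (measurable_gridGaussianLogRatio v w).stronglyMeasurable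
  have hint : Integrable (gridGaussianLogRatio u v w) (gridRestrict n Q) :=
    ((memLp_gridGaussianLogRatio hQ).integrable one_le_two).trim _ hsm
  have hllr : Integrable (llr (gridRestrict n Q) (gridRestrict n P)) (gridRestrict n Q) :=
    hint.congr hae.symm
  rw [gridEntropy, klDiv_of_ac_of_integrable hac hllr]
  have hone : ∀ (R : Measure (PathSpace l)) [IsProbabilityMeasure R],
      (gridRestrict n R).real Set.univ = 1 := by
    intro R _
    rw [gridRestrict, Measure.real, trim_measurableSet_eq _ MeasurableSet.univ, measure_univ,
      ENNReal.toReal_one]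
  have h := integral_congr_ae hae
  rw [gridLogDensity] at h
  rw [h, hone, hone, add_sub_cancel_right, gridRestrict,
    ← integral_trim _ hsm, integral_gridGaussianLogRatio hQ]

/-- If a coordinate of the increments vanishes almost surely under `Q` and has a nondegenerate Gaussian
law under `P`, then `Q` is not absolutely continuous on `𝓕ⁿ`. -/
theorem gridEntropy_eq_top
    (hQ : Q.map (gridIncr u) = Measure.pi fun p => gaussianReal 0 (v p))
    (hP : P.map (gridIncr u) = Measure.pi fun p => gaussianReal 0 (w p))
    {p : Fin n × Fin l} (hv : v p = 0) (hw : w p ≠ 0) :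
    gridEntropy n Q P = ∞ := by
  refine klDiv_of_not_ac fun hac => ?_
  have hm : MeasurableSet[gridSigma l n] {ω | gridIncr u ω p = 0} :=
    measurable_gridSigma_gridIncr (measurableSet_eq_fun (measurable_pi_apply p) measurable_const)
  have key : ∀ {R : Measure (PathSpace l)} {y : Fin n × Fin l → NNReal},
      R.map (gridIncr u) = Measure.pi (fun p => gaussianReal 0 (y p)) →
      gridRestrict n R {ω | gridIncr u ω p = 0} = gaussianReal 0 (y p) {0} := by
    intro R y hR
    rw [gridRestrict, trim_measurableSet_eq _ hm,
      ← (measurePreserving_eval (fun p => gaussianReal 0 (y p)) p).measure_preimage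
        (measurableSet_singleton (0 : ℝ)).nullMeasurableSet, ← hR,
      Measure.map_apply (measurable_gridIncr u)
        (measurable_pi_apply p (measurableSet_singleton 0))]
    rfl
  have h1 := hac (by
    rw [key hP]
    have := nullSingletonClass_gaussianReal (μ := 0) hw
    exact measure_singleton _)
  rw [key hQ, hv, gaussianReal_zero_var] at h1
  simp at h1

end Grid

/-! ### The normalized grid entropy and its limit -/

theorem half_mul_sub_one_sub_log_nonneg {x : ℝ} (hx : 0 < x) :
    0 ≤ 1 / 2 * (x - 1 - Real.log x) := by
  have := Real.log_le_sub_one_of_pos hx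
  linarith

/-- `entropyRate` in terms of the eigenvalues `vᵢ`, of which only the sum and the product enter. -/
theorem entropyRate_smul {l : ℕ} {S : Matrix (Fin l) (Fin l) ℝ} {v : Fin l → NNReal}
    (hdet : S.det = ∏ i, (v i : ℝ)) (htr : S.trace = ∑ i, (v i : ℝ)) (hv : ∀ i, v i ≠ 0)
    {c : ℝ} (hc : 0 < c) :
    entropyRate (c • S)
      = ENNReal.ofReal (∑ i, 1 / 2 * (c * v i - 1 - Real.log (c * v i))) := by
  have hv' : ∀ i, (0 : ℝ) < v i := fun i => by exact_mod_cast pos_iff_ne_zero.2 (hv i)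
  have hd : (c • S).det = ∏ i, (c * v i) := by
    rw [Matrix.det_smul, hdet, Finset.prod_mul_distrib]
    simp
  have hd0 : (c • S).det ≠ 0 := by
    rw [hd]
    exact Finset.prod_ne_zero_iff.2 fun i _ => (mul_pos hc (hv' i)).ne'
  rw [entropyRate_of_det_ne_zero hd0, hd, Real.log_prod fun i _ => (mul_pos hc (hv' i)).ne',
    Matrix.trace_smul, htr, ← Finset.mul_sum]
  congr 2
  simp [Finset.sum_sub_distrib, Finset.mul_sum]

section Cells

variable {l : ℕ} {G : ℝ → Matrix (Fin l) (Fin l) ℝ}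

theorem posSemidef_cellCov (hG : ∀ s ∈ Set.Icc (0 : ℝ) 1, (G s).PosSemidef)
    (hGint : ∀ i j, IntegrableOn (fun s => G s i j) (Set.Icc (0 : ℝ) 1)) (n : ℕ) (k : Fin n) :
    (cellCov G n k).PosSemidef :=
  posSemidef_integral
    ((ae_restrict_mem (measurableSet_gridCell n k)).mono fun s hs =>
      hG s (gridCell_subset n k hs))
    fun i j => (hGint i j).mono_set (gridCell_subset n k)

theorem smul_cellCov_eq (n : ℕ) (k : Fin n) :
    (n : ℝ) • cellCov G n k = Matrix.of fun i j =>
      ∫ s, G s i j ∂((n : ℝ≥0∞) • volume.restrict (gridCell n k)) := by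
  ext i j
  rw [Matrix.smul_apply, cellCov, Matrix.of_apply, Matrix.of_apply, integral_smul_measure]
  simp

theorem volume_gridCell (n : ℕ) (k : Fin n) : volume (gridCell n k) = (n : ℝ≥0∞)⁻¹ := by
  have hn : (0 : ℝ) < n := by exact_mod_cast k.pos
  rw [gridCell_eq, Real.volume_Ioc, ← sub_div, add_sub_cancel_left, one_div,
    ENNReal.ofReal_inv_of_pos hn, ENNReal.ofReal_natCast]

/-- Jensen's inequality on a grid cell, for the uniform probability measure on it. -/
theorem entropyRate_cellCov_le (hG : ∀ s ∈ Set.Icc (0 : ℝ) 1, (G s).PosSemidef)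
    (hGint : ∀ i j, IntegrableOn (fun s => G s i j) (Set.Icc (0 : ℝ) 1)) (n : ℕ) (k : Fin n) :
    entropyRate ((n : ℝ) • cellCov G n k) / n ≤ ∫⁻ s in gridCell n k, entropyRate (G s) := by
  have hn : (n : ℝ≥0∞) ≠ 0 := by exact_mod_cast k.pos.ne'
  have hprob : IsProbabilityMeasure ((n : ℝ≥0∞) • volume.restrict (gridCell n k)) := by
    constructor
    rw [Measure.smul_apply, Measure.restrict_apply_univ, volume_gridCell, smul_eq_mul,
      ENNReal.mul_inv_cancel hn (ENNReal.natCast_ne_top n)]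
  have h := entropyRate_integral_le
    (ν := (n : ℝ≥0∞) • volume.restrict (gridCell n k)) (G := G)
    (Measure.ae_smul_measure ((ae_restrict_mem (measurableSet_gridCell n k)).mono fun s hs =>
      hG s (gridCell_subset n k hs)) _)
    (fun i j => Integrable.smul_measure ((hGint i j).mono_set (gridCell_subset n k))
      (ENNReal.natCast_ne_top n))
  rw [← smul_cellCov_eq, lintegral_smul_measure, smul_eq_mul] at h
  exact ENNReal.div_le_of_le_mul' h

theorem sum_lintegral_gridCell {n : ℕ} (hn : 1 ≤ n) (f : ℝ → ℝ≥0∞) :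
    ∑ k, ∫⁻ s in gridCell n k, f s = ∫⁻ s in Set.Icc (0 : ℝ) 1, f s := by
  rw [← restrict_Ioc_eq_restrict_Icc, ← iUnion_gridCell hn,
    lintegral_iUnion (measurableSet_gridCell n) (pairwise_disjoint_gridCell n), tsum_fintype]

/-- The conditional expectation of `G` with respect to the partition of `(0, 1]` into the
intervals `(k/n, (k+1)/n]`. -/
noncomputable def cellAverage (G : ℝ → Matrix (Fin l) (Fin l) ℝ) (n : ℕ) (s : ℝ) :
    Matrix (Fin l) (Fin l) ℝ :=
  ∑ k, (gridCell n k).indicator (fun _ => (n : ℝ) • cellCov G n k) s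

theorem cellAverage_of_mem {n : ℕ} {k : Fin n} {s : ℝ} (hs : s ∈ gridCell n k) :
    cellAverage G n s = (n : ℝ) • cellCov G n k := by
  rw [cellAverage, Finset.sum_eq_single k _ (by simp), Set.indicator_of_mem hs]
  exact fun k' _ hk' => Set.indicator_of_notMem
    (fun hs' => Set.disjoint_left.1 (pairwise_disjoint_gridCell n hk') hs' hs) _

theorem lintegral_entropyRate_cellAverage {n : ℕ} (hn : 1 ≤ n) :
    ∫⁻ s in Set.Icc (0 : ℝ) 1, entropyRate (cellAverage G n s)
      = ∑ k, entropyRate ((n : ℝ) • cellCov G n k) / n := by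
  rw [← sum_lintegral_gridCell hn]
  refine Finset.sum_congr rfl fun k _ => ?_
  rw [setLIntegral_congr_fun (measurableSet_gridCell n k)
    (g := fun _ => entropyRate ((n : ℝ) • cellCov G n k))
    fun s hs => by simp only [cellAverage_of_mem hs], setLIntegral_const, volume_gridCell,
    div_eq_mul_inv]

theorem aemeasurable_cellAverage {ν : Measure ℝ} (n : ℕ) (i j : Fin l) :
    AEMeasurable (fun s => cellAverage G n s i j) ν := by
  have h : (fun s => cellAverage G n s i j)
      = fun s => ∑ k, (gridCell n k).indicator (fun _ => ((n : ℝ) • cellCov G n k) i j) s := by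
    ext s
    rw [cellAverage, Matrix.sum_apply]
    refine Finset.sum_congr rfl fun k _ => ?_
    by_cases hs : s ∈ gridCell n k <;> simp [hs]
  rw [h]
  exact (Finset.measurable_fun_sum _ fun k _ =>
    measurable_const.indicator (measurableSet_gridCell n k)).aemeasurable

theorem cellAverage_posSemidef (hG : ∀ s ∈ Set.Icc (0 : ℝ) 1, (G s).PosSemidef)
    (hGint : ∀ i j, IntegrableOn (fun s => G s i j) (Set.Icc (0 : ℝ) 1)) (n : ℕ) (s : ℝ) :
    (cellAverage G n s).PosSemidef := by
  refine Matrix.posSemidef_sum _ fun k _ => ?_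
  by_cases hs : s ∈ gridCell n k
  · rw [Set.indicator_of_mem hs]
    exact (posSemidef_cellCov hG hGint n k).smul n.cast_nonneg
  · rw [Set.indicator_of_notMem hs]
    exact Matrix.PosSemidef.zero

/-- Lebesgue's differentiation theorem for the averages over the grid cells. -/
theorem ae_tendsto_cellAverage
    (hGint : ∀ i j, IntegrableOn (fun s => G s i j) (Set.Icc (0 : ℝ) 1)) :
    ∀ᵐ s ∂(volume.restrict (Set.Icc (0 : ℝ) 1)), ∀ i j,
      Tendsto (fun n => cellAverage G n s i j) atTop (𝓝 (G s i j)) := by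
  rw [← restrict_Ioc_eq_restrict_Icc]
  simp only [ae_all_iff]
  intro i j
  have hloc : LocallyIntegrable ((Set.Icc (0 : ℝ) 1).indicator fun s => G s i j) volume :=
    ((hGint i j).integrable_indicator measurableSet_Icc).locallyIntegrable
  filter_upwards [ae_restrict_of_ae
    (IsUnifLocDoublingMeasure.ae_tendsto_average volume hloc 1),
    ae_restrict_mem measurableSet_Ioc] with s hs hs01
  -- up to its left end point, the cell that contains `s` is the closed ball of radius `1/(2n)`
  -- around `(⌈n s⌉ - 1/2)/n`
  have hδ : Tendsto (fun n : ℕ => 1 / 2 / (n : ℝ)) atTop (𝓝[>] 0) := by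
    refine tendsto_nhdsWithin_iff.2 ⟨tendsto_const_div_atTop_nhds_zero_nat _, ?_⟩
    filter_upwards [eventually_ge_atTop 1] with n hn
    have : (0 : ℝ) < n := by exact_mod_cast hn
    exact Set.mem_Ioi.2 (by positivity)
  have hball : ∀ n : ℕ, 1 ≤ n → ∃ k : Fin n, s ∈ gridCell n k ∧
      Metric.closedBall (((⌈(n : ℝ) * s⌉ : ℝ) - 1 / 2) / n) (1 / 2 / (n : ℝ))
        = Set.Icc ((k : ℝ) / n) (((k : ℝ) + 1) / n) := by
    intro n hn
    have hmem : s ∈ ⋃ k, gridCell n k := by rwa [iUnion_gridCell hn]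
    obtain ⟨k, hk⟩ := Set.mem_iUnion.1 hmem
    refine ⟨k, hk, ?_⟩
    rw [(mem_gridCell_iff k s).1 hk, Real.closedBall_eq_Icc]
    push_cast
    congr 1 <;> ring
  have h := hs (fun n : ℕ => ((⌈(n : ℝ) * s⌉ : ℝ) - 1 / 2) / n) (fun n : ℕ => 1 / 2 / (n : ℝ))
    hδ (by
      filter_upwards [eventually_ge_atTop 1] with n hn
      obtain ⟨k, hk, hb⟩ := hball n hn
      rw [one_mul, hb]
      rw [gridCell_eq] at hk
      exact Set.Ioc_subset_Icc_self hk)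
  rw [Set.indicator_of_mem (Set.Ioc_subset_Icc_self hs01)] at h
  refine h.congr' ?_
  filter_upwards [eventually_ge_atTop 1] with n hn
  obtain ⟨k, hk, hb⟩ := hball n hn
  have hsub : Set.Icc ((k : ℝ) / n) (((k : ℝ) + 1) / n) =ᵐ[volume] gridCell n k := by
    rw [gridCell_eq]
    exact Ioc_ae_eq_Icc.symm
  rw [hb, setAverage_congr hsub, setAverage_eq, cellAverage_of_mem hk, volume_real_gridCell,
    setIntegral_congr_fun (measurableSet_gridCell n k) (g := fun s => G s i j)
      fun s hs => Set.indicator_of_mem (gridCell_subset n k hs) _]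
  simp [cellCov]

theorem trace_cellCov
    (hGint : ∀ i j, IntegrableOn (fun s => G s i j) (Set.Icc (0 : ℝ) 1)) (n : ℕ) (k : Fin n) :
    (cellCov G n k).trace = ∫ s in gridCell n k, (G s).trace := by
  simp only [Matrix.trace, Matrix.diag_apply]
  rw [integral_finsetSum _ fun i _ => (hGint i i).mono_set (gridCell_subset n k)]
  rfl

theorem integrableOn_trace
    (hGint : ∀ i j, IntegrableOn (fun s => G s i j) (Set.Icc (0 : ℝ) 1)) :
    IntegrableOn (fun s => (G s).trace) (Set.Icc (0 : ℝ) 1) :=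
  integrable_finsetSum _ fun i _ => hGint i i

/-- The sum of the squares of the increments of the continuous increasing function
`t ↦ ∫_0^t tr G` along the grid tends to `0`. -/
theorem tendsto_sum_trace_cellCov_sq (hG : ∀ s ∈ Set.Icc (0 : ℝ) 1, (G s).PosSemidef)
    (hGint : ∀ i j, IntegrableOn (fun s => G s i j) (Set.Icc (0 : ℝ) 1)) :
    Tendsto (fun n => ∑ k, (cellCov G n k).trace ^ 2) atTop (𝓝 0) := by
  have htr := integrableOn_trace hGint
  set T : ℝ := ∫ s in Set.Icc (0 : ℝ) 1, (G s).trace with hT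
  have hnn : ∀ n k, 0 ≤ (cellCov G n k).trace := fun n k =>
    (posSemidef_cellCov hG hGint n k).trace_nonneg
  have hsum : ∀ n, 1 ≤ n → ∑ k, (cellCov G n k).trace = T := by
    intro n hn
    simp_rw [trace_cellCov hGint]
    rw [hT, ← restrict_Ioc_eq_restrict_Icc, ← iUnion_gridCell hn,
      integral_iUnion_fintype (measurableSet_gridCell n) (pairwise_disjoint_gridCell n)
        fun k => htr.mono_set (gridCell_subset n k)]
  have hT0 : 0 ≤ T := by
    rw [← hsum 1 le_rfl]
    exact Finset.sum_nonneg fun k _ => hnn 1 k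
  -- the largest increment tends to `0`, by absolute continuity of the integral
  have hsmall : ∀ ε : ℝ, 0 < ε → ∀ᶠ n in atTop, ∀ k : Fin n, (cellCov G n k).trace ≤ ε := by
    intro ε hε
    have hfin : ∫⁻ s in Set.Icc (0 : ℝ) 1, ‖(G s).trace‖ₑ ≠ ∞ := htr.2.ne
    obtain ⟨δ, hδ, h⟩ := exists_pos_setLIntegral_lt_of_measure_lt hfin
      (ENNReal.ofReal_pos.2 hε).ne'
    have hev : ∀ᶠ n : ℕ in atTop, (n : ℝ≥0∞)⁻¹ < δ :=
      ENNReal.tendsto_inv_nat_nhds_zero.eventually_lt_const hδ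
    filter_upwards [hev] with n hn k
    have hvol : (volume.restrict (Set.Icc (0 : ℝ) 1)) (gridCell n k) < δ := by
      rw [Measure.restrict_apply (measurableSet_gridCell n k),
        Set.inter_eq_left.2 (gridCell_subset n k), volume_gridCell]
      exact hn
    have h1 := h _ hvol
    rw [Measure.restrict_restrict (measurableSet_gridCell n k),
      Set.inter_eq_left.2 (gridCell_subset n k)] at h1
    have h2 : ‖(cellCov G n k).trace‖ₑ ≤ ENNReal.ofReal ε := by
      rw [trace_cellCov hGint]
      exact (enorm_integral_le_lintegral_enorm _).trans h1.le
    rw [Real.enorm_of_nonneg (hnn n k)] at h2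
    exact (ENNReal.ofReal_le_ofReal_iff hε.le).1 h2
  rw [Metric.tendsto_atTop']
  intro ε hε
  obtain ⟨N, hN⟩ := eventually_atTop.1
    ((hsmall (ε / (T + 1)) (by positivity)).and (eventually_ge_atTop 1))
  refine ⟨N, fun n hn => ?_⟩
  obtain ⟨h1, h2⟩ := hN n hn.le
  rw [Real.dist_eq, sub_zero, abs_of_nonneg (Finset.sum_nonneg fun k _ => sq_nonneg _)]
  calc ∑ k, (cellCov G n k).trace ^ 2
      ≤ ∑ k, ε / (T + 1) * (cellCov G n k).trace := Finset.sum_le_sum fun k _ => by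
        rw [sq]
        exact mul_le_mul_of_nonneg_right (h1 k) (hnn n k)
    _ = ε * (T / (T + 1)) := by
        rw [← Finset.mul_sum, hsum n h2]
        ring
    _ < ε * 1 := by
        gcongr
        rw [div_lt_one (by positivity)]
        linarith
    _ = ε := mul_one ε

end Cells

theorem ae_map_start_zero {l : ℕ} {Ω : Type*} [MeasurableSpace Ω] {P : Measure Ω}
    {X : Ω → PathSpace l} (hX : Measurable X)
    (h : ∀ᵐ ω ∂P, X ω 0 = 0) : ∀ᵐ ω ∂(P.map X), ω 0 = 0 :=
  (ae_map_iff hX.aemeasurable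
    (measurableSet_eq_fun (measurable_path_eval 0) measurable_const)).2 h

section Laws

variable {l : ℕ} {Ω : Type*} [MeasurableSpace Ω] {P : Measure Ω} [IsProbabilityMeasure P]
  {G : ℝ → Matrix (Fin l) (Fin l) ℝ} {B M : Ω → PathSpace l}

theorem IsStandardBrownianMotion.map_gridIncr (hB : IsStandardBrownianMotion B P) {n : ℕ}
    (u : Fin n → OrthonormalBasis (Fin l) ℝ (EuclideanSpace ℝ (Fin l))) :
    (P.map B).map (gridIncr u)
      = Measure.pi fun _ : Fin n × Fin l => gaussianReal 0 (n : NNReal)⁻¹ := by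
  refine hB.isWienerIntegral_one.map_gridIncr (G := fun _ => 1) hB (fun i j => aemeasurable_const)
    (fun s _ => by simp) (fun i j => (integrable_const _)) u (fun _ => (n : NNReal)⁻¹) fun k i => ?_
  have : cellCov (fun _ => (1 : Matrix (Fin l) (Fin l) ℝ)) n k
      = (n : ℝ)⁻¹ • (1 : Matrix (Fin l) (Fin l) ℝ) := by
    ext i j
    rw [cellCov, Matrix.of_apply, setIntegral_const, volume_real_gridCell, one_div]
    rfl
  rw [this, Matrix.smul_mulVec, Matrix.one_mulVec]
  simp

/-- A basis of eigenvectors for the covariance matrix of each increment turns the grid increments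
of the Gaussian martingale into independent centered Gaussian variables whose variances are the
eigenvalues. -/
theorem exists_basis_map_gridIncr
    (hG : ∀ s ∈ Set.Icc (0 : ℝ) 1, (G s).PosSemidef)
    (hGint : ∀ i j, IntegrableOn (fun s => G s i j) (Set.Icc (0 : ℝ) 1))
    (hB : IsStandardBrownianMotion B P)
    (hM : IsWienerIntegral (fun s => CFC.sqrt (G s)) B M P) (n : ℕ) :
    ∃ (u : Fin n → OrthonormalBasis (Fin l) ℝ (EuclideanSpace ℝ (Fin l)))
      (v : Fin n × Fin l → NNReal),
      (P.map M).map (gridIncr u) = Measure.pi (fun p => gaussianReal 0 (v p)) ∧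
      (∀ k, (cellCov G n k).det = ∏ i, (v (k, i) : ℝ)) ∧
      (∀ k, (cellCov G n k).trace = ∑ i, (v (k, i) : ℝ)) := by
  have hpsd := posSemidef_cellCov hG hGint n
  refine ⟨fun k => (hpsd k).1.eigenvectorBasis,
    fun p => ⟨(hpsd p.1).1.eigenvalues p.2, (hpsd p.1).eigenvalues_nonneg p.2⟩, ?_,
    fun k => (hpsd k).1.det_eq_prod_eigenvalues, fun k => (hpsd k).1.trace_eq_sum_eigenvalues⟩
  refine hM.map_gridIncr hB (fun i j => ?_) (fun s hs => sqrt_mul_transpose_sqrt (hG s hs))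
    hGint _ _ fun k i => (hpsd k).1.mulVec_eigenvectorBasis i
  exact aemeasurable_matrix_sqrt ((ae_restrict_mem measurableSet_Icc).mono fun s hs => hG s hs)
    (fun i j => (hGint i j).aemeasurable) i j

/-- Chain rule: the entropy on the grid is the sum of the entropies of the increments. Both sides are
infinite if an eigenvalue of a covariance matrix vanishes. -/
theorem gridEntropy_eq_sum
    (hG : ∀ s ∈ Set.Icc (0 : ℝ) 1, (G s).PosSemidef)
    (hGint : ∀ i j, IntegrableOn (fun s => G s i j) (Set.Icc (0 : ℝ) 1))
    (hB : IsStandardBrownianMotion B P)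
    (hM : IsWienerIntegral (fun s => CFC.sqrt (G s)) B M P) {n : ℕ} (hn : 1 ≤ n) :
    gridEntropy n (P.map M) (P.map B) = ∑ k, entropyRate ((n : ℝ) • cellCov G n k) := by
  obtain ⟨u, v, hQ, hdet, htr⟩ := exists_basis_map_gridIncr hG hGint hB hM n
  have hn' : (0 : ℝ) < n := by exact_mod_cast hn
  have hw : (n : NNReal)⁻¹ ≠ 0 := inv_ne_zero (by exact_mod_cast (by omega : n ≠ 0))
  have := Measure.isProbabilityMeasure_map (μ := P) hM.measurable.aemeasurable
  have := Measure.isProbabilityMeasure_map (μ := P) hB.measurable.aemeasurable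
  by_cases hv : ∀ p, v p ≠ 0
  · have hv' : ∀ p, (0 : ℝ) < v p := fun p => by exact_mod_cast pos_iff_ne_zero.2 (hv p)
    rw [gridEntropy_eq_ofReal (ae_map_start_zero hM.measurable hM.start_zero)
      (ae_map_start_zero hB.measurable hB.start_zero) hQ (hB.map_gridIncr u) hv (fun _ => hw),
      Fintype.sum_prod_type, ENNReal.ofReal_sum_of_nonneg]
    · refine Finset.sum_congr rfl fun k _ => ?_
      rw [entropyRate_smul (hdet k) (htr k) (fun i => hv (k, i)) hn']
      simp [mul_comm]
    · exact fun k _ => Finset.sum_nonneg fun i _ =>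
        half_mul_sub_one_sub_log_nonneg (div_pos (hv' _) (by positivity))
  · push Not at hv
    obtain ⟨⟨k, i⟩, hp⟩ := hv
    rw [gridEntropy_eq_top hQ (hB.map_gridIncr u) hp hw, eq_comm, ENNReal.sum_eq_top]
    refine ⟨k, Finset.mem_univ k, entropyRate_of_det_eq_zero ?_⟩
    rw [Matrix.det_smul, hdet, Finset.prod_eq_zero (Finset.mem_univ i) (by simp [hp]), mul_zero]

theorem gridEntropy_div_le
    (hG : ∀ s ∈ Set.Icc (0 : ℝ) 1, (G s).PosSemidef)
    (hGint : ∀ i j, IntegrableOn (fun s => G s i j) (Set.Icc (0 : ℝ) 1))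
    (hB : IsStandardBrownianMotion B P)
    (hM : IsWienerIntegral (fun s => CFC.sqrt (G s)) B M P) {n : ℕ} (hn : 1 ≤ n) :
    gridEntropy n (P.map M) (P.map B) / n
      ≤ ∫⁻ s in Set.Icc (0 : ℝ) 1, entropyRate (G s) := by
  rw [gridEntropy_eq_sum hG hGint hB hM hn, div_eq_mul_inv, Finset.sum_mul,
    ← sum_lintegral_gridCell hn]
  exact Finset.sum_le_sum fun k _ => entropyRate_cellCov_le hG hGint n k

/-- The lower bound is Fatou's lemma for the averages of `G` over the grid cells, the upper bound
is `gridEntropy_div_le`. -/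
theorem tendsto_gridEntropy_div
    (hG : ∀ s ∈ Set.Icc (0 : ℝ) 1, (G s).PosSemidef)
    (hGint : ∀ i j, IntegrableOn (fun s => G s i j) (Set.Icc (0 : ℝ) 1))
    (hB : IsStandardBrownianMotion B P)
    (hM : IsWienerIntegral (fun s => CFC.sqrt (G s)) B M P) :
    Tendsto (fun n : ℕ => gridEntropy n (P.map M) (P.map B) / n) atTop
      (𝓝 (∫⁻ s in Set.Icc (0 : ℝ) 1, entropyRate (G s))) := by
  refine tendsto_of_le_liminf_of_limsup_le ?_ ?_
  · calc ∫⁻ s in Set.Icc (0 : ℝ) 1, entropyRate (G s)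
        = ∫⁻ s in Set.Icc (0 : ℝ) 1,
            liminf (fun n => entropyRate (cellAverage G n s)) atTop := by
          refine lintegral_congr_ae ?_
          filter_upwards [ae_tendsto_cellAverage hGint] with s hs
          exact (tendsto_entropyRate (fun n => cellAverage_posSemidef hG hGint n s)
            hs).liminf_eq.symm
      _ ≤ liminf (fun n => ∫⁻ s in Set.Icc (0 : ℝ) 1, entropyRate (cellAverage G n s)) atTop :=
          lintegral_liminf_le' fun n =>
            aemeasurable_entropyRate fun i j => aemeasurable_cellAverage n i j
      _ = liminf (fun n : ℕ => gridEntropy n (P.map M) (P.map B) / n) atTop := by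
          refine liminf_congr ?_
          filter_upwards [eventually_ge_atTop 1] with n hn
          rw [lintegral_entropyRate_cellAverage hn, gridEntropy_eq_sum hG hGint hB hM hn]
          simp only [div_eq_mul_inv, Finset.sum_mul]
  · refine (limsup_le_limsup (v := fun _ => ∫⁻ s in Set.Icc (0 : ℝ) 1, entropyRate (G s))
      ?_).trans_eq (limsup_const _)
    filter_upwards [eventually_ge_atTop 1] with n hn using gridEntropy_div_le hG hGint hB hM hn

end Laws

/-! ### Fluctuations of the log-density -/

/-- The `L¹` distance of a random variable to its mean is at most its standard deviation. -/
theorem eLpNorm_sub_integral_le {α : Type*} [MeasurableSpace α] {μ : Measure α}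
    [IsProbabilityMeasure μ] {X : α → ℝ} (hX : MemLp X 2 μ) :
    eLpNorm (fun ω => X ω - ∫ x, X x ∂μ) 1 μ ≤ ENNReal.ofReal √(Var[X; μ]) := by
  have h : MemLp (fun ω => X ω - ∫ x, X x ∂μ) 2 μ := hX.sub (memLp_const _)
  refine (eLpNorm_le_eLpNorm_of_exponent_le one_le_two h.1).trans ?_
  rw [h.eLpNorm_eq_integral_rpow_norm two_ne_zero ENNReal.ofNat_ne_top,
    variance_eq_integral hX.1.aemeasurable, Real.sqrt_eq_rpow, ENNReal.toReal_ofNat]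
  simp [sq_abs]

section Finite

variable {l : ℕ} {Ω : Type*} [MeasurableSpace Ω] {P : Measure Ω} [IsProbabilityMeasure P]
  {G : ℝ → Matrix (Fin l) (Fin l) ℝ} {B M : Ω → PathSpace l}

/-- If the limiting entropy is finite, the restrictions to the grid are absolutely continuous, and
the `L¹` distance of the normalized log-density to its mean `H|_{𝓕ⁿ} / n` is at most a constant
times the square root of `∑ (tr Σₖ)² + l/n`, where `Σₖ` are the covariance matrices of the grid
increments. -/
theorem gridLogDensity_of_lintegral_ne_top
    (hG : ∀ s ∈ Set.Icc (0 : ℝ) 1, (G s).PosSemidef)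
    (hGint : ∀ i j, IntegrableOn (fun s => G s i j) (Set.Icc (0 : ℝ) 1))
    (hB : IsStandardBrownianMotion B P)
    (hM : IsWienerIntegral (fun s => CFC.sqrt (G s)) B M P)
    (hfin : ∫⁻ s in Set.Icc (0 : ℝ) 1, entropyRate (G s) ≠ ∞) {n : ℕ} (hn : 1 ≤ n) :
    gridRestrict n (P.map M) ≪ gridRestrict n (P.map B) ∧
    MemLp (gridLogDensity n (P.map M) (P.map B)) 1 (P.map M) ∧
    eLpNorm (fun ω => (1 / (n : ℝ)) * gridLogDensity n (P.map M) (P.map B) ω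
        - (gridEntropy n (P.map M) (P.map B) / n).toReal) 1 (P.map M)
      ≤ ENNReal.ofReal √(1 / 2 * Var[fun x => x ^ 2; gaussianReal 0 1]
        * (∑ k, (cellCov G n k).trace ^ 2 + l / n)) := by
  obtain ⟨u, v, hQ, hdet, htr⟩ := exists_basis_map_gridIncr hG hGint hB hM n
  have hn' : (0 : ℝ) < n := by exact_mod_cast hn
  have hw : (n : NNReal)⁻¹ ≠ 0 := inv_ne_zero (by exact_mod_cast (by omega : n ≠ 0))
  have hPM := Measure.isProbabilityMeasure_map (μ := P) hM.measurable.aemeasurable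
  have hPB := Measure.isProbabilityMeasure_map (μ := P) hB.measurable.aemeasurable
  have hM0 := ae_map_start_zero hM.measurable hM.start_zero
  have hB0 := ae_map_start_zero hB.measurable hB.start_zero
  have hBl := hB.map_gridIncr u
  -- a vanishing eigenvalue would make the entropy infinite
  have hv : ∀ p, v p ≠ 0 := by
    intro p hp
    have h := gridEntropy_div_le hG hGint hB hM hn
    rw [gridEntropy_eq_top hQ hBl hp hw, ENNReal.top_div_of_ne_top (ENNReal.natCast_ne_top n)] at h
    exact hfin (top_le_iff.1 h)
  have hv' : ∀ p, (0 : ℝ) < v p := fun p => by exact_mod_cast pos_iff_ne_zero.2 (hv p)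
  set D := gridGaussianLogRatio u v (fun _ => (n : NNReal)⁻¹) with hD
  have hae : gridLogDensity n (P.map M) (P.map B) =ᵐ[P.map M] D :=
    ae_of_ae_trim (gridSigma_le l n) (gridLogDensity_ae_eq hM0 hB0 hQ hBl hv fun _ => hw)
  have hDL : MemLp D 2 (P.map M) := memLp_gridGaussianLogRatio hQ
  have hent : (gridEntropy n (P.map M) (P.map B) / n).toReal
      = (1 / (n : ℝ)) * ∫ ω, D ω ∂(P.map M) := by
    rw [gridEntropy_eq_ofReal hM0 hB0 hQ hBl hv fun _ => hw, integral_gridGaussianLogRatio hQ,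
      ENNReal.toReal_div, ENNReal.toReal_ofReal, ENNReal.toReal_natCast]
    · ring
    · exact Finset.sum_nonneg fun p _ =>
        half_mul_sub_one_sub_log_nonneg (div_pos (hv' _) (by positivity))
  refine ⟨gridRestrict_absolutelyContinuous hM0 hB0 hQ hBl hv fun _ => hw,
    (hDL.mono_exponent one_le_two).ae_eq hae.symm, ?_⟩
  have hXL : MemLp (fun ω => (1 / (n : ℝ)) * D ω) 2 (P.map M) := hDL.const_mul _
  have hvar : Var[fun ω => (1 / (n : ℝ)) * D ω; P.map M]
      ≤ 1 / 2 * Var[fun x => x ^ 2; gaussianReal 0 1]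
        * (∑ k, (cellCov G n k).trace ^ 2 + l / n) := by
    rw [variance_const_mul, hD, variance_gridGaussianLogRatio hQ hv]
    have hV := variance_nonneg (fun x : ℝ => x ^ 2) (gaussianReal 0 1)
    have h1 : ∀ p, ((v p : ℝ) / (n : NNReal)⁻¹ - 1) ^ 2 ≤ 2 * (n ^ 2 * (v p : ℝ) ^ 2 + 1) := by
      intro p
      have : (v p : ℝ) / (n : NNReal)⁻¹ = n * v p := by
        simp [mul_comm]
      rw [this]
      nlinarith [sq_nonneg ((n : ℝ) * v p + 1)]
    have h2 : ∑ p, (v p : ℝ) ^ 2 ≤ ∑ k, (cellCov G n k).trace ^ 2 := by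
      rw [Fintype.sum_prod_type]
      refine Finset.sum_le_sum fun k _ => ?_
      rw [htr]
      exact Finset.sum_sq_le_sq_sum_of_nonneg fun i _ => (hv' (k, i)).le
    calc (1 / (n : ℝ)) ^ 2 * (1 / 4 * Var[fun x => x ^ 2; gaussianReal 0 1]
          * ∑ p, ((v p : ℝ) / (n : NNReal)⁻¹ - 1) ^ 2)
        ≤ (1 / (n : ℝ)) ^ 2 * (1 / 4 * Var[fun x => x ^ 2; gaussianReal 0 1]
          * ∑ p, 2 * (n ^ 2 * (v p : ℝ) ^ 2 + 1)) := by
          gcongr with p _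
          exact h1 p
      _ = 1 / 2 * Var[fun x => x ^ 2; gaussianReal 0 1] * (∑ p, (v p : ℝ) ^ 2 + l / n) := by
          rw [← Finset.mul_sum, Finset.sum_add_distrib, ← Finset.mul_sum]
          simp only [Finset.sum_const, Finset.card_univ, Fintype.card_prod, Fintype.card_fin,
            nsmul_eq_mul, Nat.cast_mul, mul_one]
          field_simp
          ring
      _ ≤ _ := by gcongr
  calc eLpNorm (fun ω => (1 / (n : ℝ)) * gridLogDensity n (P.map M) (P.map B) ω
        - (gridEntropy n (P.map M) (P.map B) / n).toReal) 1 (P.map M)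
      = eLpNorm (fun ω => (1 / (n : ℝ)) * D ω - ∫ x, (1 / (n : ℝ)) * D x ∂(P.map M)) 1
          (P.map M) := by
        rw [hent, integral_const_mul]
        refine eLpNorm_congr_ae ?_
        filter_upwards [hae] with ω hω
        rw [hω]
    _ ≤ _ := (eLpNorm_sub_integral_le hXL).trans
        (ENNReal.ofReal_le_ofReal (Real.sqrt_le_sqrt hvar))

/-- If `∫ entropyRate G` is finite, then `tr G - l - log det G` is integrable, with the expected
integral. -/
theorem integrableOn_of_lintegral_entropyRate_ne_top
    (hG : ∀ s ∈ Set.Icc (0 : ℝ) 1, (G s).PosSemidef)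
    (hGint : ∀ i j, IntegrableOn (fun s => G s i j) (Set.Icc (0 : ℝ) 1))
    (hfin : ∫⁻ s in Set.Icc (0 : ℝ) 1, entropyRate (G s) ≠ ∞) :
    IntervalIntegrable (fun s => (G s).trace - l - Real.log (G s).det) volume 0 1 ∧
    (∫⁻ s in Set.Icc (0 : ℝ) 1, entropyRate (G s)).toReal
      = (1 / 2) * ∫ s in (0 : ℝ)..1, ((G s).trace - l - Real.log (G s).det) := by
  have hm : ∀ i j, AEMeasurable (fun s => G s i j) (volume.restrict (Set.Icc (0 : ℝ) 1)) :=
    fun i j => (hGint i j).aemeasurable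
  set f : ℝ → ℝ := fun s => (1 / 2) * ((G s).trace - l - Real.log (G s).det) with hf
  have hfm : AEStronglyMeasurable f (volume.restrict (Set.Icc (0 : ℝ) 1)) :=
    ((((aemeasurable_matrix_trace hm).sub aemeasurable_const).sub
      (aemeasurable_matrix_det hm).log).const_mul _).aestronglyMeasurable
  have hne : ∀ᵐ s ∂(volume.restrict (Set.Icc (0 : ℝ) 1)), (G s).det ≠ 0 := by
    filter_upwards [ae_lt_top' (aemeasurable_entropyRate hm) hfin] with s hs h0
    rw [entropyRate_of_det_eq_zero h0] at hs
    exact lt_irrefl _ hs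
  have hfe : (fun s => entropyRate (G s))
      =ᵐ[volume.restrict (Set.Icc (0 : ℝ) 1)] fun s => ENNReal.ofReal (f s) := by
    filter_upwards [hne] with s hs using entropyRate_of_det_ne_zero hs
  have hf0 : 0 ≤ᵐ[volume.restrict (Set.Icc (0 : ℝ) 1)] f := by
    filter_upwards [hne, ae_restrict_mem measurableSet_Icc] with s hs hsI
    have := (hG s hsI).log_det_le_trace_sub hs
    simp only [hf, Pi.zero_apply]
    linarith
  rw [lintegral_congr_ae hfe] at hfin ⊢
  have hfi : Integrable f (volume.restrict (Set.Icc (0 : ℝ) 1)) :=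
    ⟨hfm, (hasFiniteIntegral_iff_ofReal hf0).2 hfin.lt_top⟩
  constructor
  · rw [intervalIntegrable_iff_integrableOn_Icc_of_le zero_le_one]
    refine (hfi.const_mul 2).congr (Eventually.of_forall fun s => ?_)
    simp only [hf]
    ring
  · rw [← integral_eq_lintegral_of_nonneg_ae hf0 hfm, hf, integral_const_mul,
      intervalIntegral.integral_of_le zero_le_one, integral_Icc_eq_integral_Ioc]

end Finite

theorem proposition2p2 {l : ℕ} {Ω : Type*} [MeasurableSpace Ω] (P : Measure Ω)
    [IsProbabilityMeasure P]
    (G : ℝ → Matrix (Fin l) (Fin l) ℝ)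
    (hG : ∀ s ∈ Set.Icc (0 : ℝ) 1, (G s).PosSemidef)
    (hGint : ∀ i j, IntegrableOn (fun s => G s i j) (Set.Icc (0 : ℝ) 1))
    (B M : Ω → PathSpace l)
    (hB : IsStandardBrownianMotion B P)
    (hM : IsWienerIntegral (fun s => CFC.sqrt (G s)) B M P) :
    specificRelativeEntropy (P.map M) (P.map B)
        = ∫⁻ s in Set.Icc (0 : ℝ) 1, entropyRate (G s) ∧
    ∫⁻ s in Set.Icc (0 : ℝ) 1, entropyRate (G s)
        = ⨆ n : ℕ, ⨆ _ : 1 ≤ n, gridEntropy n (P.map M) (P.map B) / n ∧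
    (∫⁻ s in Set.Icc (0 : ℝ) 1, entropyRate (G s) ≠ ∞ →
      IntervalIntegrable (fun s => (G s).trace - l - Real.log (G s).det) volume 0 1 ∧
      (∀ n : ℕ, 1 ≤ n →
        gridRestrict n (P.map M) ≪ gridRestrict n (P.map B) ∧
        MemLp (gridLogDensity n (P.map M) (P.map B)) 1 (P.map M)) ∧
      Tendsto (fun n : ℕ =>
          eLpNorm (fun ω => (1 / (n : ℝ)) * gridLogDensity n (P.map M) (P.map B) ω
            - (1 / 2) * ∫ s in (0 : ℝ)..1, ((G s).trace - l - Real.log (G s).det))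
          1 (P.map M))
        atTop (𝓝 0)) := by
  have hlim := tendsto_gridEntropy_div hG hGint hB hM
  refine ⟨?_, le_antisymm ?_ ?_, fun hfin => ?_⟩
  · have h := hlim.comp (tendsto_pow_atTop_atTop_of_one_lt (one_lt_two : 1 < 2))
    rw [specificRelativeEntropy, ← h.liminf_eq]
    simp [Function.comp_def]
  · refine le_of_tendsto hlim ?_
    filter_upwards [eventually_ge_atTop 1] with n hn
    exact le_iSup₂ (f := fun (n : ℕ) (_ : 1 ≤ n) => gridEntropy n (P.map M) (P.map B) / n) n hn
  · exact iSup₂_le fun n hn => gridEntropy_div_le hG hGint hB hM hn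
  · obtain ⟨hint, hval⟩ := integrableOn_of_lintegral_entropyRate_ne_top hG hGint hfin
    refine ⟨hint, fun n hn => ?_, ?_⟩
    · obtain ⟨h1, h2, -⟩ := gridLogDensity_of_lintegral_ne_top hG hGint hB hM hfin hn
      exact ⟨h1, h2⟩
    have hPM := Measure.isProbabilityMeasure_map (μ := P) hM.measurable.aemeasurable
    set c : ℝ := (1 / 2) * ∫ s in (0 : ℝ)..1, ((G s).trace - l - Real.log (G s).det) with hc
    set h : ℕ → ℝ := fun n => (gridEntropy n (P.map M) (P.map B) / n).toReal with hh
    set r : ℕ → ℝ := fun n => √(1 / 2 * Var[fun x => x ^ 2; gaussianReal 0 1]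
        * (∑ k, (cellCov G n k).trace ^ 2 + l / n)) with hr
    have hmean : Tendsto (fun n => ‖h n - c‖ₑ) atTop (𝓝 0) := by
      have h1 : Tendsto h atTop (𝓝 c) := by
        rw [← hval]
        exact (ENNReal.tendsto_toReal hfin).comp hlim
      have h2 := (h1.sub_const c).enorm
      rwa [sub_self, enorm_zero] at h2
    have hfluct : Tendsto (fun n => ENNReal.ofReal (r n)) atTop (𝓝 0) := by
      have h1 := ((tendsto_sum_trace_cellCov_sq hG hGint).add
        (tendsto_const_div_atTop_nhds_zero_nat (l : ℝ))).const_mul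
          (1 / 2 * Var[fun x => x ^ 2; gaussianReal 0 1])
      rw [add_zero, mul_zero] at h1
      have h2 := (ENNReal.continuous_ofReal.tendsto _).comp
        ((Real.continuous_sqrt.tendsto _).comp h1)
      rw [Real.sqrt_zero, ENNReal.ofReal_zero] at h2
      exact h2
    have hsum := hfluct.add hmean
    rw [add_zero] at hsum
    refine tendsto_of_tendsto_of_tendsto_of_le_of_le' tendsto_const_nhds hsum
      (Eventually.of_forall fun n => zero_le) ?_
    filter_upwards [eventually_ge_atTop 1] with n hn
    obtain ⟨-, h2, h3⟩ := gridLogDensity_of_lintegral_ne_top hG hGint hB hM hfin hn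
    have hsplit : (fun ω => (1 / (n : ℝ)) * gridLogDensity n (P.map M) (P.map B) ω - c)
        = (fun ω => (1 / (n : ℝ)) * gridLogDensity n (P.map M) (P.map B) ω - h n)
          + fun _ => h n - c := by
      ext ω
      simp
    rw [hsplit]
    refine (eLpNorm_add_le ((h2.1.const_mul _).sub aestronglyMeasurable_const)
      aestronglyMeasurable_const le_rfl).trans (add_le_add h3 ?_)
    rw [eLpNorm_const _ one_ne_zero (NeZero.ne _)]
    simp
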